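/- Let $\kappa\ge 3$ and $0\le\lambda\le\kappa-2$ be integers. Write $\mathbb N$ for the positive integers and $\mathbb N_0=\mathbb N\cup\{0\}$, and let $V_{\kappa,\lambda}$ be the set of all $(\gamma,\alpha,\beta)\in\mathbb N_0^3$ with $\beta,\gamma\ge 1$, $\gamma+\alpha+\beta=\kappa$ and $\alpha\ge\max\{\lambda+1-\beta,\lambda+1-\gamma\}$. A $(\kappa,\lambda)$-graphical sequence is a sequence $\mathcal G=((\gamma_i,\alpha_i,\beta_i))_{i=1}^{g+1}$ of distinct triples in $\mathbb N_0^3$ such that $(\gamma_i,\alpha_i,\beta_i)\in V_{\kappa,\lambda}$ for $1\le i\le g$; $(\gamma_1,\alpha_1,\beta_1)=(1,\lambda,\kappa-\lambda-1)$; $\beta_i\ge\beta_{i+1}$ for $1\le i\le g-1$ and $\gamma_i\le\gamma_{i+1}$ for $1\le i\le g$; $\beta_{g+1}=0$ and $\gamma_{g+1}+\alpha_{g+1}=\kappa$. For $\ell:\{1,\dots,g+1\}\to\mathbb N$ with $\ell(g+1)=1$ put $s(i)=1+\sum_{j<i}\ell(j)$. The tridiagonal sequence $\mathcal T=\mathcal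 T(\mathcal G,\ell)=((c_m,a_m,b_m))_{m=1}^{D_{\mathcal T}}$, with $D_{\mathcal T}=s(g+1)$, is defined by $(c_m,a_m,b_m)=(\gamma_i,\alpha_i,\beta_i)$ for $s(i)\le m\le s(i)+\ell(i)-1$, $1\le i\le g+1$. Its head is $h_{\mathcal T}=\ell(1)$ and its tail is $t_{\mathcal T}=|\{h_{\mathcal T}<i\le D_{\mathcal T}: (c_i,a_i,b_i)=(\kappa-\lambda-1,\lambda,1)\}|$. Put $b_0=\kappa$, $a_0=0$, and let $L_1(\mathcal T)$ be the tridiagonal matrix with rows and columns indexed by $0,\dots,D_{\mathcal T}$ whose row $i$ has the entries $c_i,a_i,b_i$ in columns $i-1,i,i+1$ (as far as these exist). Its eigenvalues are called the eigenvalues of $\mathcal T$. Let $v_0=1$, $v_1=x$ and $x v_i=b_{i-1}v_{i-1}+a_iv_i+c_{i+1}v_{i+1}$ for $1\le i\le D_{\mathcal T}-1$, and $\kappa_i=v_i(\kappa)$. The Christoffel number of an eigenvalue $\theta$ is $$\Bigl(\sum_{j=0}^{D_{\mathcal T}}\kappa_j\Bigr)\Big/\Bigl(\sum_{j=0}^{D_{\mathcal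 T}}\frac{v_j(\theta)^2}{\kappa_j}\Bigr).$$ $\mathcal T$ has property (AC) if any two eigenvalues of $\mathcal T$ that are algebraically conjugate over $\mathbb Q$ have equal Christoffel numbers. A $(\kappa,\lambda)$-quadruple $(\mathcal G,\Delta;L,\ell)$ consists of a $(\kappa,\lambda)$-graphical sequence $\mathcal G$, a subsequence $\Delta=((\gamma_{i_p},\alpha_{i_p},\beta_{i_p}))_{p=1}^{\tau}$ of $\mathcal G$ that contains the first and does not contain the last term of $\mathcal G$, and functions $\ell:\{1,\dots,g+1\}\to\mathbb N$ and $L:\{1,\dots,g+1\}\setminus\{i_1,\dots,i_\tau\}\to\mathbb N$ with $\ell(g+1)=1$ and $L(i)=\ell(i)$ for all $i$ in the domain of $L$. **Theorem.** Let $\kappa\ge3$ and $0\le\lambda\le\kappa-2$ be integers, $\mathcal G$ a $(\kappa,\lambda)$-graphical sequence with $g+1$ terms, $\Delta$ a subsequence of $\mathcal G$ with index set $\{i_1,\dots,i_\tau\}$ that contains the first and does not contain the last term of $\mathcal G$, and $L:\{1,\dots,g+1\}\setminus\{i_1,\dots,i_\tau\}\to\mathbb N$ a function. Then there is a constant $F=F(\kappa,\mathcal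 G,\Delta,L)>0$ such that for all real $\epsilon>0$ and $C=C(\kappa)>0$ there is a constant $H=H(\kappa,\lambda,\epsilon,\mathcal G,\Delta,L)>0$ (where $C$ is regarded as fixed with $\kappa$, so that $H$ may depend on it) with the following property. Let $\ell:\{1,\dots,g+1\}\to\mathbb N$ be any function for which $(\mathcal G,\Delta;L,\ell)$ is a $(\kappa,\lambda)$-quadruple and $\mathcal T=\mathcal T(\mathcal G,\ell)$ satisfies (i) property (AC), (ii) $D_{\mathcal T}\le C\,h_{\mathcal T}$, and (iii) $D_{\mathcal T}-(h_{\mathcal T}+t_{\mathcal T})>\epsilon\,h_{\mathcal T}$. If $\ell(i_p)>F$ for all $1\le p\le\tau$, then $h_{\mathcal T}\le H$. -/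

import Mathlib

namespace BI

open Polynomial

/-! ### Tridiagonal matrices, standard polynomials and Christoffel numbers

The data are the size `n` and the sequences `c` (subdiagonal), `a` (diagonal), `b` (superdiagonal);
only `c 1, ..., c n`, `a 0, ..., a n`, `b 0, ..., b (n-1)` matter. -/

/-- The `(n+1) × (n+1)` tridiagonal matrix, indexed by `0, ..., n`, whose row `i` has the entries
`c i`, `a i`, `b i` in the columns `i - 1`, `i`, `i + 1`. -/
def triMatrix (n : ℕ) (c a b : ℕ → ℝ) : Matrix (Fin (n + 1)) (Fin (n + 1)) ℝ :=
  Matrix.of fun i j =>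
    if (j : ℕ) + 1 = i then c i
    else if (j : ℕ) = i then a i
    else if (j : ℕ) = i + 1 then b i
    else 0

/-- The polynomials `v_i` given by `v_0 = 1`, `v_1 = x` and
`x v_i = b_{i-1} v_{i-1} + a_i v_i + c_{i+1} v_{i+1}` for `i ≥ 1`. -/
noncomputable def vPoly (c a b : ℕ → ℝ) : ℕ → ℝ[X]
  | 0 => 1
  | 1 => X
  | (i + 2) =>
      C (c (i + 2))⁻¹ * ((X - C (a (i + 1))) * vPoly c a b (i + 1) - C (b i) * vPoly c a b i)

/-- The numbers `κ_i = v_i(κ)` with `κ = b_0`. -/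
noncomputable def kap (c a b : ℕ → ℝ) (i : ℕ) : ℝ := (vPoly c a b i).eval (b 0)

/-- The Christoffel number
`(∑_{j=0}^n κ_j) / (∑_{j=0}^n v_j(θ)^2 / κ_j)` of the matrix at its eigenvalue `θ`. -/
noncomputable def christoffel (n : ℕ) (c a b : ℕ → ℝ) (θ : ℝ) : ℝ :=
  (∑ j ∈ Finset.range (n + 1), kap c a b j) /
    (∑ j ∈ Finset.range (n + 1), ((vPoly c a b j).eval θ) ^ 2 / kap c a b j)

/-! ### Graphical sequences

A term `(γ, α, β)` is an element `δ` of `ℕ × ℕ × ℕ`, so `γ = δ.1`, `α = δ.2.1`, `β = δ.2.2`.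
The terms of a sequence of length `g + 1` are indexed by `Fin (g + 1)`, that is by
`0, ..., g` in place of `1, ..., g + 1`. -/

/-- The set `V_{κ,λ}`. The inequality `α ≥ max {λ + 1 - β, λ + 1 - γ}` between integers is written
without subtraction. -/
def V (κ lam : ℕ) : Set (ℕ × ℕ × ℕ) :=
  {δ | 1 ≤ δ.2.2 ∧ 1 ≤ δ.1 ∧ δ.1 + δ.2.1 + δ.2.2 = κ ∧
    lam + 1 ≤ δ.2.1 + δ.2.2 ∧ lam + 1 ≤ δ.2.1 + δ.1}

/-- `(κ, λ)`-graphical sequences `(γ_i, α_i, β_i)`, `1 ≤ i ≤ g + 1` (for `λ ≤ κ - 2`). -/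
structure IsGraphicalSequence (κ lam : ℕ) {g : ℕ} (G : Fin (g + 1) → ℕ × ℕ × ℕ) : Prop where
  distinct : Function.Injective G
  mem_V : ∀ i : Fin (g + 1), (i : ℕ) < g → G i ∈ V κ lam
  first : G 0 = (1, lam, κ - lam - 1)
  beta_anti : ∀ i j : Fin (g + 1), (i : ℕ) + 1 = j → (j : ℕ) < g → (G j).2.2 ≤ (G i).2.2
  gamma_mono : ∀ i j : Fin (g + 1), (i : ℕ) + 1 = j → (G i).1 ≤ (G j).1
  beta_last : (G (Fin.last g)).2.2 = 0
  sum_last : (G (Fin.last g)).1 + (G (Fin.last g)).2.1 = κ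

/-! ### Tridiagonal sequences -/

/-- `s(i) = 1 + ∑_{j < i} ℓ(j)`, the position at which the `i`-th block starts. -/
def start {g : ℕ} (ell : Fin (g + 1) → ℕ) (i : Fin (g + 1)) : ℕ :=
  1 + ∑ j ∈ Finset.Iio i, ell j

/-- The diameter `D = s(g + 1)`. -/
def diam {g : ℕ} (ell : Fin (g + 1) → ℕ) : ℕ := start ell (Fin.last g)

/-- The tridiagonal sequence `(c_m, a_m, b_m)`: its `m`-th term is `G i` for the index `i` with
`s(i) ≤ m < s(i) + ℓ(i)`. The blocks are disjoint, so at most one summand is nonzero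
(see `tdSeq_start_add`); outside `1 ≤ m < s(g + 1) + ℓ(g + 1)` the value is `(0, 0, 0)`. -/
def tdSeq {g : ℕ} (G : Fin (g + 1) → ℕ × ℕ × ℕ) (ell : Fin (g + 1) → ℕ) (m : ℕ) : ℕ × ℕ × ℕ :=
  ∑ i : Fin (g + 1), if start ell i ≤ m ∧ m < start ell i + ell i then G i else 0

theorem start_add_le {g : ℕ} (ell : Fin (g + 1) → ℕ) {i k : Fin (g + 1)} (h : i < k) :
    start ell i + ell i ≤ start ell k := by
  have h1 : insert i (Finset.Iio i) ⊆ Finset.Iio k := by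
    intro x hx
    rw [Finset.mem_insert, Finset.mem_Iio] at hx
    rw [Finset.mem_Iio]
    rcases hx with rfl | hx
    · exact h
    · exact hx.trans h
  have h2 := Finset.sum_le_sum_of_subset (f := ell) h1
  rw [Finset.sum_insert (by simp)] at h2
  unfold start
  omega

/-- The defining property of the tridiagonal sequence: `(c_{s(i)+j}, a_{s(i)+j}, b_{s(i)+j})` is
the `i`-th term of `G` for `0 ≤ j ≤ ℓ(i) - 1`. -/
theorem tdSeq_start_add {g : ℕ} (G : Fin (g + 1) → ℕ × ℕ × ℕ) (ell : Fin (g + 1) → ℕ)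
    (i : Fin (g + 1)) (j : ℕ) (hj : j < ell i) : tdSeq G ell (start ell i + j) = G i := by
  unfold tdSeq
  rw [Finset.sum_eq_single i]
  · rw [if_pos ⟨by omega, by omega⟩]
  · intro k _ hk
    rw [if_neg]
    rintro ⟨h1, h2⟩
    rcases lt_or_gt_of_ne hk with h | h
    · have := start_add_le ell h
      omega
    · have := start_add_le ell h
      omega
  · intro h
    exact absurd (Finset.mem_univ i) h

/-- The head `ℓ(1)`. -/
def head {g : ℕ} (ell : Fin (g + 1) → ℕ) : ℕ := ell 0

/-- The tail, the number of `i` with `h < i ≤ D` and `(c_i, a_i, b_i) = (κ - λ - 1, λ, 1)`. -/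
def tail (κ lam : ℕ) {g : ℕ} (G : Fin (g + 1) → ℕ × ℕ × ℕ) (ell : Fin (g + 1) → ℕ) : ℕ :=
  ((Finset.Ioc (head ell) (diam ell)).filter
    fun i => tdSeq G ell i = (κ - lam - 1, lam, 1)).card

/-- The subdiagonal entries `c_m`. -/
def cSeq {g : ℕ} (G : Fin (g + 1) → ℕ × ℕ × ℕ) (ell : Fin (g + 1) → ℕ) (m : ℕ) : ℝ :=
  (tdSeq G ell m).1

/-- The diagonal entries, `a_0 = 0` and `a_m`. -/
def aSeq {g : ℕ} (G : Fin (g + 1) → ℕ × ℕ × ℕ) (ell : Fin (g + 1) → ℕ) (m : ℕ) : ℝ :=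
  if m = 0 then 0 else (tdSeq G ell m).2.1

/-- The superdiagonal entries, `b_0 = κ` and `b_m`. -/
def bSeq (κ : ℕ) {g : ℕ} (G : Fin (g + 1) → ℕ × ℕ × ℕ) (ell : Fin (g + 1) → ℕ) (m : ℕ) : ℝ :=
  if m = 0 then (κ : ℝ) else (tdSeq G ell m).2.2

/-- The tridiagonal matrix `L₁(T)`. -/
def L1 (κ : ℕ) {g : ℕ} (G : Fin (g + 1) → ℕ × ℕ × ℕ) (ell : Fin (g + 1) → ℕ) :
    Matrix (Fin (diam ell + 1)) (Fin (diam ell + 1)) ℝ :=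
  triMatrix (diam ell) (cSeq G ell) (aSeq G ell) (bSeq κ G ell)

/-- The set of eigenvalues of `T`. -/
def eigenvalues (κ : ℕ) {g : ℕ} (G : Fin (g + 1) → ℕ × ℕ × ℕ) (ell : Fin (g + 1) → ℕ) : Set ℝ :=
  {θ | Module.End.HasEigenvalue (Matrix.toLin' (L1 κ G ell)) θ}

/-- The Christoffel number of `T` at `θ`. -/
noncomputable def christoffelNumber (κ : ℕ) {g : ℕ} (G : Fin (g + 1) → ℕ × ℕ × ℕ)
    (ell : Fin (g + 1) → ℕ) (θ : ℝ) : ℝ :=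
  christoffel (diam ell) (cSeq G ell) (aSeq G ell) (bSeq κ G ell) θ

/-- Property (AC): eigenvalues of `T` that are algebraically conjugate over `ℚ`
(that have the same minimal polynomial) have the same Christoffel number. -/
def PropertyAC (κ : ℕ) {g : ℕ} (G : Fin (g + 1) → ℕ × ℕ × ℕ) (ell : Fin (g + 1) → ℕ) : Prop :=
  ∀ θ ∈ eigenvalues κ G ell, ∀ η ∈ eigenvalues κ G ell, IsConjRoot ℚ θ η →
    christoffelNumber κ G ell θ = christoffelNumber κ G ell η

/-! ### Quadruples -/

/-- `(κ, λ)`-quadruples `(G, Δ; L, ℓ)`. The terms of `G` being distinct, the subsequence `Δ` is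
given by the set of the indices of its terms. The functions `ℓ` and `L` have positive values
(for `L` this follows from `L_eq`). -/
structure IsQuadruple (κ lam : ℕ) {g : ℕ} (G : Fin (g + 1) → ℕ × ℕ × ℕ)
    (Δ : Finset (Fin (g + 1))) (L : {i : Fin (g + 1) // i ∉ Δ} → ℕ) (ell : Fin (g + 1) → ℕ) :
    Prop where
  graphical : IsGraphicalSequence κ lam G
  first_mem : 0 ∈ Δ
  last_notMem : Fin.last g ∉ Δ
  ell_pos : ∀ i, 1 ≤ ell i
  ell_last : ell (Fin.last g) = 1
  L_eq : ∀ i : {i : Fin (g + 1) // i ∉ Δ}, L i = ell i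

end BI

namespace BI

open Polynomial

/-! Fix `ε` and `C` and suppose that heads `h` of admissible sequences are unbounded. Since `D ≤ C
h`, the proportions `ℓ(i)/h` are bounded, so along a subsequence they converge to weights `x i`.
Condition (iii) keeps the total weight of the blocks that are neither head nor tail at least `ε`, so
one of them has positive weight. `IsGraphicalSequence.not_forall_propertyAC` shows that (AC) cannot
hold along such a sequence.

Put `w_j(θ) = v_j(θ)/√κ_j`. Equal Christoffel numbers mean equal sums `∑ w_j(θ)²`. Inside a block
`(γ, α, β)` the `w_j` satisfy a recurrence with constant coefficients, which oscillates exactly when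
`(√β - √γ)² < κ - θ < (√β + √γ)²`. Away from the last term, `|√β - √γ|` is strictly largest at the
head and tail triples. Hence (`IsGraphicalSequence.exists_interval`) there is a whole interval of
`θ` for which the head is in the growing regime, some block of positive weight oscillates, and
blocks of positive weight in the middle region oscillate uniformly.

For an eigenvalue `θ` in this interval all `w_j(θ)²` are at most `exp(o(h))` times the value at the
end `N ≥ h` of the growing region: before `N` by growth (`recurrence_normalized_le`), in the middle
by an almost conserved energy (`energy_growth`), where only block ends and blocks of weight zero
cost a factor, and at the right end by the growth argument read backwards from the last entry. If `η
≥ θ + r`, then `w_N(η)` exceeds `w_N(θ)` by a factor exponential in `h` (`recurrence_comparison`).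
So `∑ w_j(η)²` is strictly larger (`JacobiData.sum_wSeq_lt`), and by (AC) conjugate eigenvalues in
the interval are less than `r` apart, once `h` is large.

Two counts now conflict. Sine windows cut out of the long oscillating block are approximate
eigenvectors, so the interval contains at least a fixed proportion of `h` eigenvalues
(`exists_eigenvalues_of_block`). On the other hand discriminants of integer polynomials are nonzero
integers, so conjugates of high degree cannot cluster, and those of low degree are finite in number
by Northcott (`card_le_of_isConjRoot_close`). With `r` small this leaves at most `N + c (D + 1)`
eigenvalues, with `c` as small as desired. -/

/-! ### Clusters of conjugate algebraic integers -/

/-- The product is the absolute value of the resultant of `p` and its derivative, which is an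
integer and does not vanish because `p` is separable. -/
theorem one_le_prod_norm_eval_derivative {p : ℤ[X]} (hp : p.Monic)
    (hsep : (p.map (Int.castRingHom ℚ)).Separable) :
    1 ≤ ∏ z ∈ (p.map (Int.castRingHom ℂ)).roots.toFinset,
      ‖(derivative (p.map (Int.castRingHom ℂ))).eval z‖ := by
  classical
  have hinj : Function.Injective (Int.castRingHom ℂ) := Int.cast_injective
  set P := p.map (Int.castRingHom ℂ) with hP
  have hPm : P.Monic := hp.map _
  have hPsep : P.Separable := by
    have h : P = (p.map (Int.castRingHom ℚ)).map (algebraMap ℚ ℂ) := by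
      rw [Polynomial.map_map]; rfl
    rw [h]; exact hsep.map
  have hnd : P.natDegree = p.natDegree := natDegree_map_eq_of_injective hinj p
  have h1 := resultant_eq_prod_eval P (derivative P) _ le_rfl (IsAlgClosed.splits P)
  rw [hPm.leadingCoeff, one_pow, one_mul] at h1
  have h2 : resultant P (derivative P) ≠ 0 := resultant_ne_zero _ _ hPsep
  have h3 : resultant P (derivative P) = ((resultant p (derivative p) : ℤ) : ℂ) := by
    rw [hnd, hP, derivative_map, natDegree_map_eq_of_injective hinj, resultant_map_map]
    rfl
  have h4 : ∏ z ∈ P.roots.toFinset, ‖(derivative P).eval z‖ =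
      ‖(P.roots.map (derivative P).eval).prod‖ := by
    have : (P.roots.toFinset).val = P.roots := by
      rw [Multiset.toFinset_val, (nodup_roots hPsep).dedup]
    rw [← norm_prod, Finset.prod, this]
  rw [h4, ← h1, h3]
  rw [h3] at h2
  have h5 : resultant p (derivative p) ≠ 0 := by exact_mod_cast h2
  rw [Complex.norm_intCast]
  exact_mod_cast Int.one_le_abs h5

theorem norm_eval_derivative_eq_prod {P : ℂ[X]} (hP : P.Monic) (hsep : P.Separable) {z : ℂ}
    (hz : z ∈ P.roots.toFinset) :
    ‖(derivative P).eval z‖ = ∏ w ∈ P.roots.toFinset.erase z, ‖z - w‖ := by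
  classical
  have hnd := nodup_roots hsep
  rw [Multiset.mem_toFinset] at hz
  rw [(IsAlgClosed.splits P).eval_root_derivative hP hz, ← norm_prod, Finset.prod]
  congr 2
  rw [Finset.erase_val, Multiset.toFinset_val, hnd.dedup]

/-- If many roots of a monic separable integer polynomial lie close together, then its degree is
bounded. -/
theorem one_le_of_cluster {p : ℤ[X]} (hp : p.Monic)
    (hsep : (p.map (Int.castRingHom ℚ)).Separable) {R r : ℝ} (hR : 1 ≤ R) (hr : 0 ≤ r)
    (hroots : ∀ z ∈ (p.map (Int.castRingHom ℂ)).roots, ‖z‖ ≤ R) (E : Finset ℂ)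
    (hE : E ⊆ (p.map (Int.castRingHom ℂ)).roots.toFinset)
    (hclose : ∀ z ∈ E, ∀ w ∈ E, ‖z - w‖ ≤ r) :
    1 ≤ r ^ (E.card * (E.card - 1)) * (2 * R) ^ (p.natDegree * p.natDegree) := by
  classical
  have hinj : Function.Injective (Int.castRingHom ℂ) := Int.cast_injective
  have h0 := one_le_prod_norm_eval_derivative hp hsep
  set P := p.map (Int.castRingHom ℂ) with hP
  have hPm : P.Monic := hp.map _
  have hPsep : P.Separable := by
    have h : P = (p.map (Int.castRingHom ℚ)).map (algebraMap ℚ ℂ) := by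
      rw [Polynomial.map_map]; rfl
    rw [h]; exact hsep.map
  set S := P.roots.toFinset with hS
  have hcard : S.card = p.natDegree := by
    rw [hS, Multiset.toFinset_card_of_nodup (nodup_roots hPsep),
      ← (IsAlgClosed.splits P).natDegree_eq_card_roots, hP, natDegree_map_eq_of_injective hinj]
  have hb : ∀ z ∈ S, ∀ w ∈ S, ‖z - w‖ ≤ 2 * R := by
    intro z hz w hw
    have h1 := hroots z (Multiset.mem_toFinset.1 hz)
    have h2 := hroots w (Multiset.mem_toFinset.1 hw)
    linarith [norm_sub_le z w]
  have h2R : 1 ≤ 2 * R := by linarith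
  have hin : ∀ z ∈ S, ∏ w ∈ S.erase z, ‖z - w‖ ≤
      (if z ∈ E then r ^ (E.card - 1) else 1) * (2 * R) ^ p.natDegree := by
    intro z hz
    -- Pairs inside `E` also receive the spare factor `2 * R ≥ 1`, so that the powers of `2 * R` can
    -- be collected without case distinction.
    have hle : ∀ w ∈ S.erase z, ‖z - w‖ ≤ (if z ∈ E ∧ w ∈ E then r else 1) * (2 * R) := by
      intro w hw
      split_ifs with h
      · have := hclose z h.1 w h.2
        nlinarith
      · rw [one_mul]; exact hb z hz w (Finset.mem_of_mem_erase hw)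
    refine (Finset.prod_le_prod (fun _ _ => norm_nonneg _) hle).trans ?_
    rw [Finset.prod_mul_distrib, Finset.prod_const]
    have hpow : (2 * R) ^ (S.erase z).card ≤ (2 * R) ^ p.natDegree :=
      pow_le_pow_right₀ h2R (by rw [← hcard]; exact Finset.card_le_card (Finset.erase_subset _ _))
    have heq : (∏ w ∈ S.erase z, if z ∈ E ∧ w ∈ E then r else 1) =
        if z ∈ E then r ^ (E.card - 1) else 1 := by
      split_ifs with h
      · simp only [h, true_and]
        rw [Finset.prod_ite, Finset.prod_const_one, mul_one, Finset.prod_const]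
        congr 1
        rw [← Finset.card_erase_of_mem h]
        congr 1
        ext w
        simp only [Finset.mem_filter, Finset.mem_erase]
        constructor
        · rintro ⟨⟨a, _⟩, b⟩; exact ⟨a, b⟩
        · rintro ⟨a, b⟩; exact ⟨⟨a, hE b⟩, b⟩
      · simp [h]
    rw [heq]
    refine mul_le_mul_of_nonneg_left hpow ?_
    split_ifs <;> positivity
  calc (1 : ℝ) ≤ ∏ z ∈ S, ‖(derivative P).eval z‖ := h0
    _ = ∏ z ∈ S, ∏ w ∈ S.erase z, ‖z - w‖ :=
        Finset.prod_congr rfl fun z hz => norm_eval_derivative_eq_prod hPm hPsep hz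
    _ ≤ ∏ z ∈ S, ((if z ∈ E then r ^ (E.card - 1) else 1) * (2 * R) ^ p.natDegree) :=
        Finset.prod_le_prod (fun _ _ => Finset.prod_nonneg fun _ _ => norm_nonneg _) hin
    _ = _ := by
        rw [Finset.prod_mul_distrib, Finset.prod_const, hcard, ← pow_mul, Finset.prod_ite,
          Finset.prod_const_one, mul_one, Finset.prod_const, ← pow_mul]
        congr 2
        rw [Finset.filter_mem_eq_inter, Finset.inter_eq_right.2 hE, mul_comm]

/-- Northcott: there are finitely many algebraic integers of bounded degree all of whose conjugates
are bounded. -/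
theorem finite_setOf_isIntegral_bounded (R : ℝ) (d : ℕ) :
    {θ : ℝ | IsIntegral ℤ θ ∧ (minpoly ℤ θ).natDegree ≤ d ∧
      ∀ z ∈ ((minpoly ℤ θ).map (Int.castRingHom ℂ)).roots, ‖z‖ ≤ R}.Finite := by
  classical
  -- The bound on the coefficients of a monic polynomial of degree at most `d` with roots of size at
  -- most `R`.
  set B : ℝ := max R 1 ^ d * d.choose (d / 2) with hB
  have hU : (Set.Icc (-⌈B⌉) ⌈B⌉ : Set ℤ).Finite := Set.finite_Icc _ _
  refine (bUnion_roots_finite (Int.castRingHom ℝ) d hU).subset ?_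
  rintro θ ⟨hi, hd, hr⟩
  simp only [Set.mem_iUnion]
  refine ⟨minpoly ℤ θ, ⟨hd, fun i => ?_⟩, ?_⟩
  · have hq : ((minpoly ℤ θ).map (Int.castRingHom ℚ)).map (algebraMap ℚ ℂ) =
        (minpoly ℤ θ).map (Int.castRingHom ℂ) := by
      rw [Polynomial.map_map]; rfl
    have := coeff_bdd_of_roots_le (B := R) (d := d) (algebraMap ℚ ℂ)
      (p := (minpoly ℤ θ).map (Int.castRingHom ℚ)) ((minpoly.monic hi).map _)
      (IsAlgClosed.splits _) (natDegree_map_le.trans hd) (by rw [hq]; exact hr) i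
    rw [hq, coeff_map, eq_intCast, Complex.norm_intCast] at this
    have h2 : ((|(minpoly ℤ θ).coeff i| : ℤ) : ℝ) ≤ (⌈B⌉ : ℤ) := by
      push_cast
      exact this.trans (Int.le_ceil _)
    have h3 := Int.cast_le.1 h2
    exact ⟨(abs_le.1 h3).1, (abs_le.1 h3).2⟩
  · simp only [Finset.mem_coe, Multiset.mem_toFinset]
    rw [mem_roots ((minpoly.monic hi).map _).ne_zero, IsRoot, eval_map]
    exact minpoly.aeval ℤ θ

/-- The minimal polynomials of distinct conjugacy classes of roots of `P` have total degree at most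
the degree of `P`. -/
theorem sum_natDegree_minpoly_le {P : ℤ[X]} (hP : P.Monic) (E : Finset ℝ)
    (hE : ∀ θ ∈ E, aeval θ P = 0) :
    ∑ q ∈ E.image (minpoly ℚ), q.natDegree ≤ P.natDegree := by
  classical
  have hint : ∀ θ ∈ E, IsIntegral ℚ θ := fun θ hθ =>
    IsIntegral.tower_top (R := ℤ) ⟨P, hP, hE θ hθ⟩
  have hdvd : ∏ q ∈ E.image (minpoly ℚ), q ∣ P.map (Int.castRingHom ℚ) := by
    refine Finset.prod_dvd_of_coprime ?_ ?_
    · intro p hp q hq hpq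
      simp only [Finset.coe_image, Set.mem_image, Finset.mem_coe] at hp hq
      obtain ⟨θ, hθ, rfl⟩ := hp
      obtain ⟨η, hη, rfl⟩ := hq
      have hi := minpoly.irreducible (hint θ hθ)
      have hj := minpoly.irreducible (hint η hη)
      refine (hi.coprime_iff_not_dvd).2 fun h => hpq ?_
      exact eq_of_monic_of_associated (minpoly.monic (hint θ hθ)) (minpoly.monic (hint η hη))
        (hi.associated_of_dvd hj h)
    · intro q hq
      obtain ⟨θ, hθ, rfl⟩ := Finset.mem_image.1 hq
      refine minpoly.dvd ℚ θ ?_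
      have := hE θ hθ
      rwa [← aeval_map_algebraMap ℚ θ P] at this
  have hne : P.map (Int.castRingHom ℚ) ≠ 0 := (hP.map _).ne_zero
  have h1 := natDegree_le_of_dvd hdvd hne
  rw [natDegree_prod_of_monic, natDegree_map_eq_of_injective (Int.cast_injective)] at h1
  · exact h1
  · intro q hq
    obtain ⟨θ, hθ, rfl⟩ := Finset.mem_image.1 hq
    exact minpoly.monic (hint θ hθ)

/-- If any two conjugate elements of a set `E` of roots of a monic integer polynomial `P` are close
to each other, then, up to a bounded number, `E` contains only a small proportion of the roots. -/
theorem card_le_of_isConjRoot_close {R c : ℝ} (hR : 1 ≤ R) (hc : 0 < c) :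
    ∃ r : ℝ, 0 < r ∧ ∃ N : ℕ, ∀ P : ℤ[X], P.Monic →
      (∀ z ∈ (P.map (Int.castRingHom ℂ)).roots, ‖z‖ ≤ R) →
      ∀ E : Finset ℝ, (∀ θ ∈ E, aeval θ P = 0) →
        (∀ θ ∈ E, ∀ η ∈ E, IsConjRoot ℚ θ η → |θ - η| ≤ r) →
        (E.card : ℝ) ≤ N + c * P.natDegree := by
  classical
  -- A class of degree `d > 2 / c` with `e > c * d` members in `E` has `e > 2`, so `e * (e - 1) ≥ e
  -- ^ 2 / 2` and `k * (e * (e - 1)) ≥ d ^ 2`. With `r = (1 / (4 * R)) ^ k` the product in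
  -- `one_le_of_cluster` is then at most `(1 / 2) ^ (d * d)`.
  obtain ⟨k, hk⟩ := exists_nat_ge (2 / c ^ 2)
  set d0 := ⌈2 / c⌉₊ with hd0
  set Z := finite_setOf_isIntegral_bounded R d0 with hZ
  have hR4 : 1 ≤ 4 * R := by linarith
  refine ⟨(1 / (4 * R)) ^ k, by positivity, Z.toFinset.card, fun P hP hroots E hE hclose => ?_⟩
  have hint : ∀ θ ∈ E, IsIntegral ℤ θ := fun θ hθ => ⟨P, hP, hE θ hθ⟩
  have hdvd : ∀ θ ∈ E, minpoly ℤ θ ∣ P := fun θ hθ =>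
    minpoly.isIntegrallyClosed_dvd (hint θ hθ) (hE θ hθ)
  have hmr : ∀ θ ∈ E, ∀ z ∈ ((minpoly ℤ θ).map (Int.castRingHom ℂ)).roots, ‖z‖ ≤ R := by
    intro θ hθ z hz
    refine hroots z ?_
    exact Multiset.mem_of_le (roots.le_of_dvd (hP.map _).ne_zero
      (Polynomial.map_dvd _ (hdvd θ hθ))) hz
  have hfrac : ∀ θ ∈ E, minpoly ℚ θ = (minpoly ℤ θ).map (Int.castRingHom ℚ) := fun θ hθ =>
    minpoly.isIntegrallyClosed_eq_field_fractions' ℚ (hint θ hθ)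
  have hdeg : ∀ θ ∈ E, (minpoly ℚ θ).natDegree = (minpoly ℤ θ).natDegree := fun θ hθ => by
    rw [hfrac θ hθ, natDegree_map_eq_of_injective Int.cast_injective]
  -- Outside the finite set `Z`, which does not depend on `P`, each conjugacy class contributes at
  -- most `c` times its degree; the degrees of the classes add up to at most that of `P`.
  have hfiber : ∀ q ∈ (E.filter (· ∉ Z.toFinset)).image (minpoly ℚ),
      ((((E.filter (· ∉ Z.toFinset)).filter fun θ => minpoly ℚ θ = q).card : ℕ) : ℝ) ≤
        c * q.natDegree := by
    intro q hq
    obtain ⟨θ, hθ, rfl⟩ := Finset.mem_image.1 hq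
    rw [Finset.mem_filter] at hθ
    obtain ⟨hθE, hθZ⟩ := hθ
    have hbig : d0 < (minpoly ℤ θ).natDegree := by
      by_contra hcon
      refine hθZ ((Set.Finite.mem_toFinset _).2 ⟨hint θ hθE, not_lt.1 hcon, hmr θ hθE⟩)
    by_contra hcon
    push Not at hcon
    rw [hdeg θ hθE] at hcon
    set F := (E.filter (· ∉ Z.toFinset)).filter fun η => minpoly ℚ η = minpoly ℚ θ with hF
    have hFE : ∀ η ∈ F, η ∈ E ∧ minpoly ℚ η = minpoly ℚ θ := fun η hη => by
      simp only [hF, Finset.mem_filter] at hη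
      exact ⟨hη.1.1, hη.2⟩
    have hinjR : Function.Injective (fun x : ℝ => (x : ℂ)) := Complex.ofReal_injective
    have hpm := minpoly.monic (hint θ hθE)
    have hcl := one_le_of_cluster hpm
      (by rw [← hfrac θ hθE]
          exact (minpoly.irreducible (IsIntegral.tower_top (hint θ hθE))).separable)
      hR (r := (1 / (4 * R)) ^ k) (by positivity) (hmr θ hθE) (F.image fun x : ℝ => (x : ℂ))
      (by
        intro z hz
        obtain ⟨η, hη, rfl⟩ := Finset.mem_image.1 hz
        have h1 := (hFE η hη).2
        have h2 : minpoly ℤ η = minpoly ℤ θ := by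
          rw [hfrac η (hFE η hη).1, hfrac θ hθE] at h1
          exact map_injective _ Int.cast_injective h1
        rw [Multiset.mem_toFinset, mem_roots (hpm.map _).ne_zero, IsRoot, eval_map, ← h2]
        have h3 := minpoly.aeval ℤ η
        have h4 := congrArg (algebraMap ℝ ℂ) h3
        rw [← aeval_algebraMap_apply, map_zero] at h4
        exact h4)
      (by
        intro z hz w hw
        obtain ⟨η, hη, rfl⟩ := Finset.mem_image.1 hz
        obtain ⟨ξ, hξ, rfl⟩ := Finset.mem_image.1 hw
        rw [← Complex.ofReal_sub, Complex.norm_real, Real.norm_eq_abs]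
        refine hclose η (hFE η hη).1 ξ (hFE ξ hξ).1 ?_
        rw [isConjRoot_def, (hFE η hη).2, (hFE ξ hξ).2])
    rw [Finset.card_image_of_injective _ hinjR] at hcl
    set d := (minpoly ℤ θ).natDegree with hd
    set e := F.card with he
    have hd2 : 2 / c < d := (Nat.le_ceil _).trans_lt (by exact_mod_cast hbig)
    have hcd : 2 < c * d := by rw [div_lt_iff₀ hc] at hd2; linarith
    have he2 : (2 : ℝ) < e := hcd.trans hcon
    have he1 : 1 ≤ e := by
      have : (1 : ℝ) ≤ e := by linarith
      exact_mod_cast this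
    have hexp : d * d ≤ k * (e * (e - 1)) := by
      have hkc : 2 ≤ k * c ^ 2 := by rwa [div_le_iff₀ (by positivity)] at hk
      have : (d * d : ℝ) ≤ k * (e * (e - 1)) := by
        have h1 : (c * d) ^ 2 ≤ 2 * (e * (e - 1) : ℝ) := by nlinarith
        have h2 : (0 : ℝ) ≤ k := Nat.cast_nonneg k
        nlinarith [mul_le_mul_of_nonneg_left h1 h2, sq_nonneg (d : ℝ)]
      have h3 : ((d * d : ℕ) : ℝ) ≤ ((k * (e * (e - 1)) : ℕ) : ℝ) := by
        push_cast [Nat.cast_sub he1]; exact this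
      exact_mod_cast h3
    have hd1 : d * d ≠ 0 := by
      have : 0 < d := by omega
      positivity
    have hlt : ((1 / (4 * R)) ^ k) ^ (e * (e - 1)) * (2 * R) ^ (d * d) < 1 := by
      rw [← pow_mul]
      calc (1 / (4 * R)) ^ (k * (e * (e - 1))) * (2 * R) ^ (d * d)
          ≤ (1 / (4 * R)) ^ (d * d) * (2 * R) ^ (d * d) := by
            refine mul_le_mul_of_nonneg_right ?_ (by positivity)
            refine pow_le_pow_of_le_one (by positivity) ?_ hexp
            rw [div_le_one (by positivity)]; exact hR4
        _ = (1 / 2) ^ (d * d) := by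
            rw [← mul_pow]; congr 1; field_simp; norm_num
        _ < 1 := pow_lt_one₀ (by norm_num) (by norm_num) hd1
    linarith
  have hsum : ((E.filter (· ∉ Z.toFinset)).card : ℝ) ≤ c * P.natDegree := by
    rw [Finset.card_eq_sum_card_image (minpoly ℚ)]
    push_cast
    refine (Finset.sum_le_sum hfiber).trans ?_
    rw [← Finset.mul_sum]
    refine mul_le_mul_of_nonneg_left ?_ hc.le
    have := sum_natDegree_minpoly_le hP (E.filter (· ∉ Z.toFinset))
      fun θ hθ => hE θ (Finset.mem_filter.1 hθ).1
    exact_mod_cast this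
  have hsplit := Finset.card_filter_add_card_filter_not (s := E) (· ∈ Z.toFinset)
  have hle : (E.filter (· ∈ Z.toFinset)).card ≤ Z.toFinset.card :=
    Finset.card_le_card fun x hx => (Finset.mem_filter.1 hx).2
  have h1 : (E.card : ℝ) =
      (E.filter (· ∈ Z.toFinset)).card + (E.filter (· ∉ Z.toFinset)).card := by
    exact_mod_cast hsplit.symm
  have h2 : ((E.filter (· ∈ Z.toFinset)).card : ℝ) ≤ Z.toFinset.card := by exact_mod_cast hle
  linarith

/-! ### Growth of solutions of three-term recurrences -/

/-- In the region where `t ≤ √B - √C` a solution of the recurrence stays positive and grows. -/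
theorem recurrence_growth {B C f : ℕ → ℝ} {t : ℝ} {N : ℕ} (ht : 0 ≤ t) (hB0 : 0 ≤ B 0) (hC0 : C 0 = 0)
    (h0 : C 1 * f 1 = (B 0 + C 0 - t ^ 2) * f 0)
    (hrec : ∀ i < N, C (i + 2) * f (i + 2) =
      (B (i + 1) + C (i + 1) - t ^ 2) * f (i + 1) - B i * f i)
    (hanti : ∀ i < N, B (i + 1) ≤ B i) (hC : ∀ i, 1 ≤ i → i ≤ N → 0 < C i)
    (hreg : ∀ i ≤ N, t ≤ √(B i) - √(C i)) (hf : 0 < f 0) :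
    ∀ i ≤ N, 0 < f i ∧ √(B i) * (√(B i) - t) * f i ≤ C (i + 1) * f (i + 1) := by
  intro i
  induction i with
  | zero =>
    intro _
    refine ⟨hf, ?_⟩
    rw [h0, hC0, add_zero]
    refine mul_le_mul_of_nonneg_right ?_ hf.le
    have h1 := hreg 0 (Nat.zero_le _)
    rw [hC0, Real.sqrt_zero, sub_zero] at h1
    have hB : √(B 0) * √(B 0) = B 0 := Real.mul_self_sqrt hB0
    nlinarith
  | succ i ih =>
    intro hi
    obtain ⟨hp, hle⟩ := ih (by omega)
    have hr := hreg i (by omega)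
    have hr' := hreg (i + 1) hi
    have hc := hC (i + 1) (by omega) hi
    have hsc : 0 < √(C (i + 1)) := Real.sqrt_pos.2 hc
    have hs1 : t < √(B (i + 1)) := by linarith
    have hss : √(B (i + 1)) ≤ √(B i) := Real.sqrt_le_sqrt (hanti i (by omega))
    have hs0 : 0 < √(B i) := by linarith
    have hB1 : 0 < B (i + 1) := Real.sqrt_pos.1 (by linarith)
    have hBi : 0 < B i := Real.sqrt_pos.1 hs0
    have hf1 : 0 < f (i + 1) := by
      have : 0 < √(B i) * (√(B i) - t) * f i :=
        mul_pos (mul_pos hs0 (by linarith)) hp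
      exact pos_of_mul_pos_right (this.trans_le hle) hc.le
    refine ⟨hf1, ?_⟩
    rw [hrec i (by omega)]
    set x := √(B (i + 1)) with hx
    set y := √(B i) with hy
    have hxx : B (i + 1) = x * x := (Real.mul_self_sqrt hB1.le).symm
    have hyy : B i = y * y := (Real.mul_self_sqrt hBi.le).symm
    have hzz : C (i + 1) = √(C (i + 1)) * √(C (i + 1)) := (Real.mul_self_sqrt hc.le).symm
    set z := √(C (i + 1)) with hz
    -- After cancelling `x * (x - t) * f (i + 1)` the claim reads `B i * f i ≤ (C (i + 1) + t * (x -
    -- t)) * f (i + 1)`. Multiplied by `x - t`, it follows from the induction hypothesis with `x ≤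
    -- y`, and from `C (i + 1) ≤ (x - t) ^ 2`, which is the region condition.
    have hbf : B i * f i * (x - t) ≤ x * C (i + 1) * f (i + 1) := by
      have h2 : x * (y * (y - t) * f i) ≤ x * (C (i + 1) * f (i + 1)) := by
        gcongr
      have h3 : B i * f i * (x - t) ≤ x * (y * (y - t) * f i) := by
        rw [hyy]
        have h1 : 0 ≤ y * f i := by positivity
        have h4 : y * (x - t) ≤ x * (y - t) := by nlinarith
        nlinarith [mul_le_mul_of_nonneg_left h4 h1]
      linarith
    have hxt : 0 < x - t := by linarith
    have hsq : z * z ≤ (x - t) * (x - t) := by nlinarith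
    refine le_of_mul_le_mul_right ?_ hxt
    have h5 : x * C (i + 1) * f (i + 1) ≤
        ((C (i + 1) + x * t - t ^ 2) * f (i + 1)) * (x - t) := by
      have h6 : x * C (i + 1) ≤ (C (i + 1) + x * t - t ^ 2) * (x - t) := by
        rw [hzz]
        nlinarith [mul_le_mul_of_nonneg_left hsq ht]
      nlinarith [mul_le_mul_of_nonneg_right h6 hf1.le]
    rw [hxx]
    nlinarith

/-- The normalised solution `f i / s i` is bounded by a multiple of its value at the end of the
region of growth. -/
theorem recurrence_normalized_le {B C f s : ℕ → ℝ} {t K : ℝ} {N : ℕ} (ht : 0 ≤ t) (hB0 : 0 ≤ B 0)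
    (hC0 : C 0 = 0) (h0 : C 1 * f 1 = (B 0 + C 0 - t ^ 2) * f 0)
    (hrec : ∀ i < N, C (i + 2) * f (i + 2) =
      (B (i + 1) + C (i + 1) - t ^ 2) * f (i + 1) - B i * f i)
    (hanti : ∀ i < N, B (i + 1) ≤ B i) (hC : ∀ i, 1 ≤ i → i ≤ N → 1 ≤ C i)
    (hCK : ∀ i ≤ N, C i ≤ K ^ 2) (hK : 1 ≤ K)
    (hreg : ∀ i ≤ N, t ≤ √(B i) - √(C i)) (hf : 0 < f 0)
    (hs : ∀ i ≤ N, 0 < s i) (hsrec : ∀ i < N, √(C (i + 1)) * s (i + 1) = √(B i) * s i) :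
    ∀ i ≤ N, 0 < f i ∧ f i / s i ≤ K * (f N / s N) := by
  have hg := recurrence_growth ht hB0 hC0 h0 hrec hanti
    (fun i h1 h2 => one_pos.trans_le (hC i h1 h2)) hreg hf
  have hw : ∀ i ≤ N, 0 < f i / s i := fun i hi => div_pos (hg i hi).1 (hs i hi)
  -- The growth inequality in normalised form. As `√(C i) ≤ √(B i) - t`, it makes `√(C i) * (f i / s
  -- i)` nondecreasing, and for `i ≥ 1` the factor `√(C i)` lies between `1` and `K`.
  have hstep : ∀ i < N, (√(B i) - t) * (f i / s i) ≤ √(C (i + 1)) * (f (i + 1) / s (i + 1)) := by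
    intro i hi
    have h1 := (hg i hi.le).2
    have hsi := hs i hi.le
    have hsi1 := hs (i + 1) hi
    have hc : (0 : ℝ) < C (i + 1) := one_pos.trans_le (hC (i + 1) (by omega) hi)
    have hsc : 0 < √(C (i + 1)) := Real.sqrt_pos.2 hc
    have hr := hsrec i hi
    have hsb : 0 < √(B i) := by
      have : 0 < √(B i) * s i := hr ▸ mul_pos hsc hsi1
      exact pos_of_mul_pos_left this hsi.le
    have hcc : √(C (i + 1)) * √(C (i + 1)) = C (i + 1) := Real.mul_self_sqrt hc.le
    rw [mul_div_assoc', mul_div_assoc', div_le_div_iff₀ hsi hsi1]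
    refine le_of_mul_le_mul_left ?_ (mul_pos hsc hsb)
    calc √(C (i + 1)) * √(B i) * ((√(B i) - t) * f i * s (i + 1))
        = (√(B i) * (√(B i) - t) * f i) * (√(C (i + 1)) * s (i + 1)) := by ring
      _ = (√(B i) * (√(B i) - t) * f i) * (√(B i) * s i) := by rw [hr]
      _ ≤ (C (i + 1) * f (i + 1)) * (√(B i) * s i) := by gcongr
      _ = √(C (i + 1)) * √(B i) * (√(C (i + 1)) * f (i + 1) * s i) := by
          linear_combination -(f (i + 1) * √(B i) * s i) * hcc
  have hC1 : ∀ i, 1 ≤ i → i ≤ N → 1 ≤ √(C i) := fun i h1 h2 => by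
    rw [Real.one_le_sqrt]; exact hC i h1 h2
  have hBt : ∀ i < N, 1 ≤ √(B i) - t := by
    intro i hi
    have h1 := hC1 (i + 1) (by omega) hi
    have h2 := hreg (i + 1) hi
    have h3 := Real.sqrt_le_sqrt (hanti i hi)
    linarith
  have hmono : ∀ j, ∀ i, 1 ≤ i → i + j ≤ N →
      √(C i) * (f i / s i) ≤ √(C (i + j)) * (f (i + j) / s (i + j)) := by
    intro j
    induction j with
    | zero => intro i _ _; simp
    | succ j ih =>
      intro i h1 h2
      refine (ih i h1 (by omega)).trans (le_trans ?_ (hstep (i + j) (by omega)))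
      refine mul_le_mul_of_nonneg_right ?_ (hw _ (by omega)).le
      have := hreg (i + j) (by omega)
      linarith
  have hlast : ∀ i, 1 ≤ i → i ≤ N → √(C i) * (f i / s i) ≤ K * (f N / s N) := by
    intro i h1 h2
    have := hmono (N - i) i h1 (by omega)
    rw [Nat.add_sub_cancel' h2] at this
    refine this.trans (mul_le_mul_of_nonneg_right ?_ (hw N le_rfl).le)
    exact (Real.sqrt_le_left (by linarith)).2 (hCK N le_rfl)
  intro i hi
  refine ⟨(hg i hi).1, ?_⟩
  rcases Nat.eq_zero_or_pos i with rfl | hi0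
  -- At `i = 0` the monotone quantity vanishes because `C 0 = 0`, so the first step has to be taken
  -- by `hstep` itself.
  · rcases Nat.eq_zero_or_pos N with rfl | hN
    · nlinarith [hw 0 le_rfl]
    · refine le_trans ?_ (hlast 1 le_rfl hN)
      refine le_trans ?_ (hstep 0 hN)
      nlinarith [hBt 0 hN, hw 0 (Nat.zero_le _)]
  · refine le_trans ?_ (hlast i hi0 hi)
    nlinarith [hC1 i hi0 hi, hw i hi]

/-- Solutions for a larger parameter grow exponentially faster in the region of growth. -/
theorem recurrence_comparison {a b c f g : ℕ → ℝ} {θ η κ μ : ℝ} {N : ℕ}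
    (hμ0 : 0 ≤ μ) (hμ : κ * μ ≤ η - θ)
    (hf0 : f 0 = 1) (hg0 : g 0 = 1) (hf1 : c 1 * f 1 = (θ - a 0) * f 0)
    (hg1 : c 1 * g 1 = (η - a 0) * g 0)
    (hf : ∀ i, i + 2 ≤ N → c (i + 2) * f (i + 2) = (θ - a (i + 1)) * f (i + 1) - b i * f i)
    (hg : ∀ i, i + 2 ≤ N → c (i + 2) * g (i + 2) = (η - a (i + 1)) * g (i + 1) - b i * g i)
    (hb : ∀ i ≤ N, 0 ≤ b i) (hc : ∀ i, 1 ≤ i → i ≤ N → 0 < c i) (ha : ∀ i ≤ N, θ - a i ≤ κ)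
    (hfp : ∀ i ≤ N, 0 < f i) (hgp : ∀ i ≤ N, 0 < g i) :
    (1 + μ) ^ N * f N ≤ g N := by
  -- The ratio of consecutive terms is larger for `g` by the factor `1 + μ`. In the induction, `c (i
  -- + 2) * f (i + 2) ≤ κ * f (i + 1)` lets the surplus `η - θ` pay for `μ`.
  have key : ∀ i < N, (1 + μ) * (f (i + 1) * g i) ≤ g (i + 1) * f i := by
    intro i
    induction i with
    | zero =>
      intro hN
      have hc1 := hc 1 le_rfl hN
      rw [hf0, hg0] at *
      refine le_of_mul_le_mul_left ?_ hc1
      have := ha 0 (Nat.zero_le _)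
      nlinarith
    | succ i ih =>
      intro hi
      have h1 := ih (by omega)
      have hc1 := hc (i + 2) (by omega) hi
      have e1 := hf i hi
      have e2 := hg i hi
      have p1 := hfp (i + 1) (by omega)
      have p2 := hgp (i + 1) (by omega)
      have p3 := hfp i (by omega)
      have p4 := hgp i (by omega)
      have pb := hb i (by omega)
      have h2 : f (i + 1) * g i ≤ g (i + 1) * f i := by
        nlinarith [mul_nonneg hμ0 (mul_pos p1 p4).le]
      have h3 := mul_le_mul_of_nonneg_left h2 pb
      refine le_of_mul_le_mul_left ?_ hc1
      have h4 : c (i + 2) * f (i + 2) ≤ κ * f (i + 1) := by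
        have := mul_le_mul_of_nonneg_right (ha (i + 1) (by omega)) p1.le
        nlinarith [mul_nonneg pb p3.le]
      have h5 : μ * (c (i + 2) * f (i + 2)) * g (i + 1) ≤ (η - θ) * f (i + 1) * g (i + 1) := by
        refine mul_le_mul_of_nonneg_right ?_ p2.le
        nlinarith [mul_le_mul_of_nonneg_left h4 hμ0, mul_le_mul_of_nonneg_right hμ p1.le]
      have e3 : c (i + 2) * ((1 + μ) * (f (i + 1 + 1) * g (i + 1))) =
          (c (i + 2) * f (i + 2)) * g (i + 1) + μ * (c (i + 2) * f (i + 2)) * g (i + 1) := by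
        ring
      have e4 : c (i + 2) * (g (i + 1 + 1) * f (i + 1)) =
          (c (i + 2) * g (i + 2)) * f (i + 1) := by ring
      rw [e3, e4, e2]
      have e5 : (c (i + 2) * f (i + 2)) * g (i + 1) =
        ((θ - a (i + 1)) * f (i + 1) - b i * f i) * g (i + 1) := by rw [e1]
      nlinarith
  have : ∀ i ≤ N, (1 + μ) ^ i * f i ≤ g i := by
    intro i
    induction i with
    | zero => intro _; simp [hf0, hg0]
    | succ i ih =>
      intro hi
      have h1 := ih (by omega)
      have h2 := key i hi
      have p1 := hfp (i + 1) hi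
      have p3 := hfp i (by omega)
      refine le_of_mul_le_mul_right ?_ p3
      calc (1 + μ) ^ (i + 1) * f (i + 1) * f i
          = (1 + μ) * f (i + 1) * ((1 + μ) ^ i * f i) := by ring
        _ ≤ (1 + μ) * f (i + 1) * g i := by gcongr
        _ ≤ g (i + 1) * f i := by linarith
  exact this N le_rfl

/-- The energy `w_j² + w_{j+1}² - 2 x_j w_j w_{j+1}` of a sequence grows by a bounded factor, and
only at the places `j` where the recurrence `w_{j+2} = 2 x_j w_{j+1} - w_j`, `x_{j+1} = x_j`
fails. -/
theorem energy_growth {w x : ℕ → ℝ} {δ K : ℝ} {m N : ℕ} (bad : Finset ℕ) (hδ : 0 < δ) (hδ1 : δ ≤ 1)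
    (hK : 1 ≤ K) (hx : ∀ j, |x j| ≤ 1 - δ)
    (hstep : ∀ j, m ≤ j → j < N →
      w (j + 1) ^ 2 + w (j + 2) ^ 2 ≤ K * (w j ^ 2 + w (j + 1) ^ 2))
    (hgood : ∀ j, m ≤ j → j < N → j ∉ bad →
      x (j + 1) = x j ∧ w (j + 2) = 2 * x j * w (j + 1) - w j) :
    ∀ j, m ≤ j → j ≤ N → w j ^ 2 + w (j + 1) ^ 2 ≤
      2 / δ * (2 * K / δ) ^ bad.card * (w m ^ 2 + w (m + 1) ^ 2) := by
  classical
  -- This form is invariant under `(u, v) ↦ (v, 2 x v - u)`, and for `|x| ≤ 1 - δ` it is comparable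
  -- with the sum of squares. A bad place costs the factor `2 * K / δ` for passing to the sum of
  -- squares and back.
  set Q : ℕ → ℝ := fun j => w j ^ 2 + w (j + 1) ^ 2 - 2 * x j * w j * w (j + 1) with hQ
  have hlow : ∀ j, δ * (w j ^ 2 + w (j + 1) ^ 2) ≤ Q j := by
    intro j
    obtain ⟨h1, h2⟩ := abs_le.1 (hx j)
    simp only [hQ]
    nlinarith [sq_nonneg (w j - w (j + 1)), sq_nonneg (w j + w (j + 1))]
  have hupp : ∀ j, Q j ≤ 2 * (w j ^ 2 + w (j + 1) ^ 2) := by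
    intro j
    obtain ⟨h1, h2⟩ := abs_le.1 (hx j)
    simp only [hQ]
    nlinarith [sq_nonneg (w j - w (j + 1)), sq_nonneg (w j + w (j + 1))]
  have hL : 1 ≤ 2 * K / δ := by rw [le_div_iff₀ hδ]; linarith
  have hmain : ∀ k, m + k ≤ N →
      Q (m + k) ≤ (2 * K / δ) ^ (bad.filter (· < m + k)).card * Q m := by
    have hQm : 0 ≤ Q m := le_trans (by positivity) (hlow m)
    intro k
    induction k with
    | zero =>
      intro _
      exact le_mul_of_one_le_left hQm (one_le_pow₀ hL)
    | succ k ih =>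
      intro hk
      have h1 := ih (by omega)
      by_cases hb : m + k ∈ bad
      · have hc : (bad.filter (· < m + k)).card + 1 ≤ (bad.filter (· < m + (k + 1))).card := by
          rw [← Finset.card_insert_of_notMem (a := m + k) (by simp)]
          refine Finset.card_le_card ?_
          intro y hy
          rw [Finset.mem_insert, Finset.mem_filter] at hy
          rw [Finset.mem_filter]
          rcases hy with rfl | ⟨h, h'⟩
          · exact ⟨hb, by omega⟩
          · exact ⟨h, by omega⟩
        calc Q (m + (k + 1)) ≤ 2 * (w (m + k + 1) ^ 2 + w (m + k + 2) ^ 2) := hupp (m + k + 1)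
          _ ≤ 2 * (K * (w (m + k) ^ 2 + w (m + k + 1) ^ 2)) := by
              linarith [hstep (m + k) (by omega) (by omega)]
          _ = (2 * K / δ) * (δ * (w (m + k) ^ 2 + w (m + k + 1) ^ 2)) := by field_simp
          _ ≤ (2 * K / δ) * Q (m + k) := by gcongr; exact hlow _
          _ ≤ (2 * K / δ) * ((2 * K / δ) ^ (bad.filter (· < m + k)).card * Q m) := by gcongr
          _ = (2 * K / δ) ^ ((bad.filter (· < m + k)).card + 1) * Q m := by ring
          _ ≤ _ := mul_le_mul_of_nonneg_right (pow_le_pow_right₀ hL hc) hQm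
      · obtain ⟨e1, e2⟩ := hgood (m + k) (by omega) (by omega) hb
        have : Q (m + (k + 1)) = Q (m + k) := by
          simp only [hQ]
          rw [show m + (k + 1) = m + k + 1 by ring, e1, show m + k + 1 + 1 = m + k + 2 by ring, e2]
          ring
        rw [this]
        refine h1.trans (mul_le_mul_of_nonneg_right (pow_le_pow_right₀ hL ?_) hQm)
        refine Finset.card_le_card fun y hy => ?_
        rw [Finset.mem_filter] at hy ⊢
        exact ⟨hy.1, by omega⟩
  intro j hmj hjN
  obtain ⟨k, rfl⟩ := Nat.exists_eq_add_of_le hmj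
  have h1 := hmain k hjN
  have h2 := hlow (m + k)
  have h3 : (2 * K / δ) ^ (bad.filter (· < m + k)).card ≤ (2 * K / δ) ^ bad.card :=
    pow_le_pow_right₀ hL (Finset.card_le_card (Finset.filter_subset _ _))
  have hQm : 0 ≤ Q m := le_trans (by positivity) (hlow m)
  refine le_of_mul_le_mul_left ?_ hδ
  calc _ ≤ Q (m + k) := h2
    _ ≤ (2 * K / δ) ^ bad.card * Q m := h1.trans (by gcongr)
    _ ≤ (2 * K / δ) ^ bad.card * (2 * (w m ^ 2 + w (m + 1) ^ 2)) := by gcongr; exact hupp m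
    _ = _ := by field_simp

/-! ### Tridiagonal matrices with constant row sum and monotone entries -/

/-- The conditions on the entries of a tridiagonal matrix with constant row sum that hold for
tridiagonal sequences. -/
structure JacobiData (n : ℕ) (κ : ℝ) (c a b : ℕ → ℝ) : Prop where
  pos : 1 ≤ n
  sum : ∀ i ≤ n, c i + a i + b i = κ
  c_zero : c 0 = 0
  a_zero : a 0 = 0
  c_one : c 1 = 1
  b_last : b n = 0
  b_pos : ∀ i < n, 1 ≤ b i
  c_pos : ∀ i, 1 ≤ i → i ≤ n → 1 ≤ c i
  a_nonneg : ∀ i ≤ n, 0 ≤ a i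
  b_anti : ∀ i < n, b (i + 1) ≤ b i
  c_mono : ∀ i < n, c i ≤ c (i + 1)

/-- The normalised values `v_j(θ) / √κ_j`. -/
noncomputable def wSeq (c a b : ℕ → ℝ) (θ : ℝ) (j : ℕ) : ℝ :=
  (vPoly c a b j).eval θ / √(kap c a b j)

namespace JacobiData

variable {n : ℕ} {κ : ℝ} {c a b : ℕ → ℝ}

theorem b_zero (h : JacobiData n κ c a b) : b 0 = κ := by
  have := h.sum 0 (Nat.zero_le _)
  rw [h.c_zero, h.a_zero] at this
  linarith

theorem one_le (h : JacobiData n κ c a b) : 1 ≤ κ := by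
  rw [← h.b_zero]; exact h.b_pos 0 h.pos

theorem b_nonneg (h : JacobiData n κ c a b) {i : ℕ} (hi : i ≤ n) : 0 ≤ b i := by
  rcases hi.lt_or_eq with h1 | rfl
  · linarith [h.b_pos i h1]
  · rw [h.b_last]

theorem c_nonneg (h : JacobiData n κ c a b) {i : ℕ} (hi : i ≤ n) : 0 ≤ c i := by
  rcases Nat.eq_zero_or_pos i with rfl | h1
  · rw [h.c_zero]
  · linarith [h.c_pos i h1 hi]

theorem b_le (h : JacobiData n κ c a b) {i : ℕ} (hi : i ≤ n) : b i ≤ κ := by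
  linarith [h.sum i hi, h.c_nonneg hi, h.a_nonneg i hi]

theorem c_le (h : JacobiData n κ c a b) {i : ℕ} (hi : i ≤ n) : c i ≤ κ := by
  linarith [h.sum i hi, h.b_nonneg hi, h.a_nonneg i hi]

theorem a_le (h : JacobiData n κ c a b) {i : ℕ} (hi : i ≤ n) : a i ≤ κ := by
  linarith [h.sum i hi, h.b_nonneg hi, h.c_nonneg hi]

theorem b_antitone (h : JacobiData n κ c a b) {i j : ℕ} (hij : i ≤ j) (hj : j ≤ n) :
    b j ≤ b i := by
  induction j, hij using Nat.le_induction with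
  | base => exact le_rfl
  | succ j hij ih => exact (h.b_anti j hj).trans (ih (by omega))

theorem c_monotone (h : JacobiData n κ c a b) {i j : ℕ} (hij : i ≤ j) (hj : j ≤ n) :
    c i ≤ c j := by
  induction j, hij using Nat.le_induction with
  | base => exact le_rfl
  | succ j hij ih => exact (ih (by omega)).trans (h.c_mono j hj)

theorem eval_vPoly_zero (θ : ℝ) : (vPoly c a b 0).eval θ = 1 := by simp [vPoly]

theorem eval_vPoly_one (h : JacobiData n κ c a b) (θ : ℝ) :
    c 1 * (vPoly c a b 1).eval θ = (θ - a 0) * (vPoly c a b 0).eval θ := by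
  simp [vPoly, h.c_one, h.a_zero]

theorem eval_vPoly_add_two (h : JacobiData n κ c a b) (θ : ℝ) {i : ℕ} (hi : i + 2 ≤ n) :
    c (i + 2) * (vPoly c a b (i + 2)).eval θ =
      (θ - a (i + 1)) * (vPoly c a b (i + 1)).eval θ - b i * (vPoly c a b i).eval θ := by
  have := h.c_pos (i + 2) (by omega) hi
  have h0 : c (i + 2) ≠ 0 := by linarith
  rw [vPoly]
  simp only [eval_mul, eval_C, eval_sub, eval_X]
  rw [mul_inv_cancel_left₀ h0]

/-- Because all row sums equal `κ = b 0`, the three-term recurrence at `κ` telescopes to this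
balance relation, which makes conjugation by the diagonal matrix of the `√κ_i` symmetrise the
matrix. -/
theorem kap_succ (h : JacobiData n κ c a b) {i : ℕ} (hi : i < n) :
    c (i + 1) * kap c a b (i + 1) = b i * kap c a b i := by
  induction i with
  | zero =>
    have := h.eval_vPoly_one (b 0)
    rw [h.a_zero, sub_zero] at this
    exact this
  | succ i ih =>
    have h1 := h.eval_vPoly_add_two (b 0) (i := i) hi
    have h2 := ih (by omega)
    have h3 := h.sum (i + 1) (by omega)
    rw [← h.b_zero] at h3
    unfold kap at *
    rw [h1, ← h2, ← h3]
    ring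

theorem kap_pos (h : JacobiData n κ c a b) {i : ℕ} (hi : i ≤ n) : 0 < kap c a b i := by
  induction i with
  | zero => simp [kap, vPoly]
  | succ i ih =>
    have h1 := h.kap_succ (i := i) hi
    have h2 := mul_pos (one_pos.trans_le (h.b_pos i hi)) (ih (by omega))
    exact pos_of_mul_pos_right (h1 ▸ h2) (h.c_nonneg hi)

theorem sqrt_kap_pos (h : JacobiData n κ c a b) {i : ℕ} (hi : i ≤ n) : 0 < √(kap c a b i) :=
  Real.sqrt_pos.2 (h.kap_pos hi)

theorem sqrt_kap_succ (h : JacobiData n κ c a b) {i : ℕ} (hi : i < n) :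
    √(c (i + 1)) * √(kap c a b (i + 1)) = √(b i) * √(kap c a b i) := by
  rw [← Real.sqrt_mul (h.c_nonneg hi), ← Real.sqrt_mul (h.b_nonneg hi.le), h.kap_succ hi]

theorem wSeq_zero (θ : ℝ) : wSeq c a b θ 0 = 1 := by simp [wSeq, vPoly, kap]

theorem wSeq_one (h : JacobiData n κ c a b) (θ : ℝ) :
    √(b 0) * √(c 1) * wSeq c a b θ 1 = θ * wSeq c a b θ 0 := by
  have h1 := h.sqrt_kap_succ h.pos
  have h2 := h.sqrt_kap_pos h.pos
  have h3 : √(kap c a b 0) = 1 := by simp [kap, vPoly]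
  have h4 : √(c 1) = 1 := by rw [h.c_one, Real.sqrt_one]
  rw [h3, mul_one, zero_add, h4, one_mul] at h1
  rw [wSeq_zero, h4, ← h1, wSeq, mul_one]
  field_simp
  simp [vPoly]

/-- The recurrence of the symmetrised matrix; on a constant stretch of entries it becomes `w_{i+2} =
2 x w_{i+1} - w_i`. -/
theorem wSeq_add_two (h : JacobiData n κ c a b) (θ : ℝ) {i : ℕ} (hi : i + 2 ≤ n) :
    √(b (i + 1)) * √(c (i + 2)) * wSeq c a b θ (i + 2) =
      (θ - a (i + 1)) * wSeq c a b θ (i + 1) - √(b i) * √(c (i + 1)) * wSeq c a b θ i := by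
  have k0 := h.sqrt_kap_pos (i := i) (by omega)
  have k1 := h.sqrt_kap_pos (i := i + 1) (by omega)
  have k2 := h.sqrt_kap_pos (i := i + 2) (by omega)
  have e0 := h.sqrt_kap_succ (i := i) (by omega)
  have e1 := h.sqrt_kap_succ (i := i + 1) (by omega)
  have hv := h.eval_vPoly_add_two θ hi
  have hb := Real.mul_self_sqrt (h.b_nonneg (i := i) (by omega))
  have hc := Real.mul_self_sqrt (h.c_nonneg (i := i + 2) (by omega))
  have t2 : √(b (i + 1)) * √(c (i + 2)) * wSeq c a b θ (i + 2) =
      c (i + 2) * (vPoly c a b (i + 2)).eval θ / √(kap c a b (i + 1)) := by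
    rw [wSeq, mul_div_assoc', div_eq_div_iff k2.ne' k1.ne']
    linear_combination (-(√(c (i + 2)) * (vPoly c a b (i + 2)).eval θ)) * e1 +
      ((vPoly c a b (i + 2)).eval θ * √(kap c a b (i + 2))) * hc
  have t0 : √(b i) * √(c (i + 1)) * wSeq c a b θ i =
      b i * (vPoly c a b i).eval θ / √(kap c a b (i + 1)) := by
    rw [wSeq, mul_div_assoc', div_eq_div_iff k0.ne' k1.ne']
    linear_combination (√(b i) * (vPoly c a b i).eval θ) * e0 +
      ((vPoly c a b i).eval θ * √(kap c a b i)) * hb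
  rw [t2, t0, hv, wSeq]
  ring

theorem wSeq_sq (h : JacobiData n κ c a b) (θ : ℝ) {i : ℕ} (hi : i ≤ n) :
    wSeq c a b θ i ^ 2 = (vPoly c a b i).eval θ ^ 2 / kap c a b i := by
  rw [wSeq, div_pow, Real.sq_sqrt (h.kap_pos hi).le]

theorem christoffel_eq (h : JacobiData n κ c a b) (θ : ℝ) :
    christoffel n c a b θ = (∑ j ∈ Finset.range (n + 1), kap c a b j) /
      ∑ j ∈ Finset.range (n + 1), wSeq c a b θ j ^ 2 := by
  rw [christoffel]
  congr 1
  exact Finset.sum_congr rfl fun j hj => (h.wSeq_sq θ (by simpa [Nat.lt_succ_iff] using hj)).symm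

theorem sum_wSeq_pos (θ : ℝ) : 0 < ∑ j ∈ Finset.range (n + 1), wSeq c a b θ j ^ 2 := by
  refine Finset.sum_pos' (fun _ _ => sq_nonneg _) ⟨0, by simp, ?_⟩
  rw [wSeq_zero]; norm_num

/-- The two Christoffel numbers have the same positive numerator. This is the form in which (AC) is
used. -/
theorem sum_wSeq_eq_of_christoffel_eq (h : JacobiData n κ c a b) {θ η : ℝ}
    (he : christoffel n c a b θ = christoffel n c a b η) :
    ∑ j ∈ Finset.range (n + 1), wSeq c a b θ j ^ 2 =
      ∑ j ∈ Finset.range (n + 1), wSeq c a b η j ^ 2 := by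
  rw [h.christoffel_eq, h.christoffel_eq] at he
  have hk : 0 < ∑ j ∈ Finset.range (n + 1), kap c a b j :=
    Finset.sum_pos (fun j hj => h.kap_pos (by simpa [Nat.lt_succ_iff] using hj)) ⟨0, by simp⟩
  have h1 := sum_wSeq_pos (n := n) (c := c) (a := a) (b := b) θ
  have h2 := sum_wSeq_pos (n := n) (c := c) (a := a) (b := b) η
  rw [div_eq_div_iff h1.ne' h2.ne'] at he
  exact (mul_left_cancel₀ hk.ne' he).symm

/-- In the left region, where `t ≤ √b - √c`, the values `v_i(θ)` are positive and the normalised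
values are bounded by the last one. -/
theorem left_region (h : JacobiData n κ c a b) {θ T : ℝ} (hθ : θ ≤ κ) (hT : κ - θ ≤ T ^ 2)
    (hT0 : 0 ≤ T) {N : ℕ} (hN : N < n) (hreg : ∀ i ≤ N, T ≤ √(b i) - √(c i)) :
    ∀ i ≤ N, 0 < (vPoly c a b i).eval θ ∧ wSeq c a b θ i ≤ κ * wSeq c a b θ N := by
  have hκ := h.one_le
  have ht : √(κ - θ) ≤ T := by
    rw [Real.sqrt_le_left hT0]; exact hT
  have htt : √(κ - θ) ^ 2 = κ - θ := Real.sq_sqrt (by linarith)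
  refine recurrence_normalized_le (B := b) (C := c) (f := fun i => (vPoly c a b i).eval θ)
    (s := fun i => √(kap c a b i)) (t := √(κ - θ)) (K := κ) (N := N) (Real.sqrt_nonneg _)
    (h.b_nonneg (Nat.zero_le _)) h.c_zero ?_ ?_ (fun i hi => h.b_anti i (by omega))
    (fun i h1 h2 => h.c_pos i h1 (by omega)) (fun i hi => ?_) hκ
    (fun i hi => ht.trans (hreg i hi)) (by simp [vPoly]) (fun i hi => h.sqrt_kap_pos (by omega))
    (fun i hi => h.sqrt_kap_succ (by omega))
  · have := h.sum 0 (Nat.zero_le _)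
    rw [h.eval_vPoly_one, htt]
    congr 1
    linarith
  · intro i hi
    have := h.sum (i + 1) (by omega)
    have h2 := h.eval_vPoly_add_two θ (i := i) (by omega)
    rw [htt, h2]
    congr 2
    linarith
  · have := h.c_le (i := i) (by omega)
    nlinarith

/-- `v_n(θ)` does not vanish if `θ` is an eigenvalue. -/
theorem eval_vPoly_last_ne_zero (h : JacobiData n κ c a b) {θ : ℝ}
    (heig : b (n - 1) * (vPoly c a b (n - 1)).eval θ = (θ - a n) * (vPoly c a b n).eval θ) :
    (vPoly c a b n).eval θ ≠ 0 := by
  intro h0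
  have hn := h.pos
  -- A zero at `n` forces one at `n - 1`, and two consecutive zeros propagate down to `v_0 = 1`.
  have key : ∀ k, k + 1 ≤ n →
      (vPoly c a b (n - k)).eval θ = 0 ∧ (vPoly c a b (n - k - 1)).eval θ = 0 := by
    intro k
    induction k with
    | zero =>
      intro _
      refine ⟨h0, ?_⟩
      rw [h0, mul_zero] at heig
      have := h.b_pos (n - 1) (by omega)
      exact (mul_eq_zero.1 heig).resolve_left (by linarith)
    | succ k ih =>
      intro hk
      obtain ⟨i1, i2⟩ := ih (by omega)
      refine ⟨i2, ?_⟩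
      have e := h.eval_vPoly_add_two θ (i := n - (k + 1) - 1) (by omega)
      rw [show n - (k + 1) - 1 + 2 = n - k by omega, i1,
        show n - (k + 1) - 1 + 1 = n - k - 1 by omega, i2] at e
      have := h.b_pos (n - (k + 1) - 1) (by omega)
      have e2 : b (n - (k + 1) - 1) * (vPoly c a b (n - (k + 1) - 1)).eval θ = 0 := by linarith
      exact (mul_eq_zero.1 e2).resolve_left (by linarith)
  have := (key (n - 1) (by omega)).2
  rw [show n - (n - 1) - 1 = 0 by omega, eval_vPoly_zero] at this
  exact one_ne_zero this

/-- In the right region, where `t ≤ √c - √b`, the normalised values at an eigenvalue are bounded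
by the first one. -/
theorem right_region (h : JacobiData n κ c a b) {θ T : ℝ} (hθ : θ ≤ κ) (hT : κ - θ ≤ T ^ 2)
    (hT0 : 0 ≤ T)
    (heig : b (n - 1) * (vPoly c a b (n - 1)).eval θ = (θ - a n) * (vPoly c a b n).eval θ)
    {m : ℕ} (hm : 1 ≤ m) (hreg : ∀ i, m ≤ i → i ≤ n → T ≤ √(c i) - √(b i)) :
    ∀ i, m ≤ i → i ≤ n → wSeq c a b θ i ^ 2 ≤ κ ^ 2 * wSeq c a b θ m ^ 2 := by
  have hκ := h.one_le
  have ht : √(κ - θ) ≤ T := by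
    rw [Real.sqrt_le_left hT0]; exact hT
  have htt : √(κ - θ) ^ 2 = κ - θ := Real.sq_sqrt (by linarith)
  have hvn := h.eval_vPoly_last_ne_zero heig
  intro i hmi hin
  have hmn : m ≤ n := hmi.trans hin
  set z := (vPoly c a b n).eval θ with hz
  -- The sequence is read backwards from `n`, with `b` and `c` exchanged; the eigenvalue equation
  -- serves as the initial condition. Multiplying by `z = v_n(θ)` makes the starting value `z * z`
  -- positive whatever the sign of `z`.
  have := recurrence_normalized_le (B := fun i => c (n - i)) (C := fun i => b (n - i))
    (f := fun i => (vPoly c a b (n - i)).eval θ * z)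
    (s := fun i => √(kap c a b (n - i))) (t := √(κ - θ)) (K := κ) (N := n - m)
    (Real.sqrt_nonneg _) (h.c_nonneg (Nat.sub_le _ _)) (by simpa using h.b_last)
    (by
      have h1 := h.sum n le_rfl
      simp only [Nat.sub_zero]
      rw [← mul_assoc, heig, htt, ← hz]
      have : θ - a n = c n + b n - (κ - θ) := by linarith
      rw [this]; ring)
    (by
      intro i hi
      have h1 := h.sum (n - (i + 1)) (by omega)
      have h2 := h.eval_vPoly_add_two θ (i := n - (i + 2)) (by omega)
      rw [show n - (i + 2) + 2 = n - i by omega,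
        show n - (i + 2) + 1 = n - (i + 1) by omega] at h2
      rw [htt]
      have : θ - a (n - (i + 1)) = c (n - (i + 1)) + b (n - (i + 1)) - (κ - θ) := by linarith
      rw [← this]
      linear_combination z * h2)
    (fun i hi => h.c_monotone (by omega) (by omega))
    (fun i h1 h2 => h.b_pos _ (by omega))
    (fun i hi => by
      have := h.b_le (i := n - i) (by omega)
      nlinarith)
    hκ (fun i hi => ht.trans (hreg (n - i) (by omega) (by omega)))
    (mul_self_pos.2 hvn)
    (fun i hi => h.sqrt_kap_pos (by omega))
    (fun i hi => by
      have := h.sqrt_kap_succ (i := n - (i + 1)) (by omega)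
      rw [show n - (i + 1) + 1 = n - i by omega] at this
      exact this.symm)
    (n - i) (by omega)
  beta_reduce at this
  rw [show n - (n - i) = i by omega, show n - (n - m) = m by omega] at this
  obtain ⟨h1, h2⟩ := this
  have h3 : 0 < (vPoly c a b i).eval θ * z / √(kap c a b i) := div_pos h1 (h.sqrt_kap_pos hin)
  have h4 := pow_le_pow_left₀ h3.le h2 2
  have e1 : (vPoly c a b i).eval θ * z / √(kap c a b i) = z * wSeq c a b θ i := by
    rw [wSeq]; ring
  have e2 : (vPoly c a b m).eval θ * z / √(kap c a b m) = z * wSeq c a b θ m := by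
    rw [wSeq]; ring
  rw [e1, e2] at h4
  have hz2 : 0 < z ^ 2 := by positivity
  refine le_of_mul_le_mul_left ?_ hz2
  linarith

/-- The leading coefficient of the recurrence is at least `1` and the others are at most `κ` in
absolute value. This bounds the loss at bad places and on leaving the growing region. -/
theorem wSeq_step (h : JacobiData n κ c a b) {θ : ℝ} (hθ0 : 0 ≤ θ) (hθ : θ ≤ κ) {j : ℕ}
    (hj : j + 2 ≤ n) :
    wSeq c a b θ (j + 1) ^ 2 + wSeq c a b θ (j + 2) ^ 2 ≤
      (1 + 2 * κ ^ 2) * (wSeq c a b θ j ^ 2 + wSeq c a b θ (j + 1) ^ 2) := by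
  have hκ := h.one_le
  have hw := h.wSeq_add_two θ hj
  set x := wSeq c a b θ j
  set y := wSeq c a b θ (j + 1)
  set z := wSeq c a b θ (j + 2)
  have hp : 1 ≤ √(b (j + 1)) * √(c (j + 2)) := by
    have h1 : 1 ≤ √(b (j + 1)) := Real.one_le_sqrt.2 (h.b_pos _ (by omega))
    have h2 : 1 ≤ √(c (j + 2)) := Real.one_le_sqrt.2 (h.c_pos _ (by omega) (by omega))
    nlinarith
  have hq : √(b j) * √(c (j + 1)) ≤ κ := by
    have h1 : √(b j) ≤ √κ := Real.sqrt_le_sqrt (h.b_le (by omega))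
    have h2 : √(c (j + 1)) ≤ √κ := Real.sqrt_le_sqrt (h.c_le (by omega))
    calc √(b j) * √(c (j + 1)) ≤ √κ * √κ := by gcongr
      _ = κ := Real.mul_self_sqrt (by linarith)
  have hq0 : 0 ≤ √(b j) * √(c (j + 1)) := by positivity
  set p := √(b (j + 1)) * √(c (j + 2))
  set q := √(b j) * √(c (j + 1))
  have ha1 := h.a_nonneg (j + 1) (by omega)
  have ha2 := h.a_le (i := j + 1) (by omega)
  set d := θ - a (j + 1) with hd
  have hd2 : d ^ 2 ≤ κ ^ 2 := by
    exact sq_le_sq' (by linarith) (by linarith)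
  have hq2 : q ^ 2 ≤ κ ^ 2 := by gcongr
  have h1 : z ^ 2 ≤ (p * z) ^ 2 := by
    have : 1 ≤ p ^ 2 := one_le_pow₀ hp
    nlinarith [sq_nonneg z]
  have h2 : (d * y - q * x) ^ 2 ≤ 2 * (d ^ 2 * y ^ 2) + 2 * (q ^ 2 * x ^ 2) := by
    nlinarith [sq_nonneg (d * y + q * x)]
  have h3 : d ^ 2 * y ^ 2 ≤ κ ^ 2 * y ^ 2 := by gcongr
  have h4 : q ^ 2 * x ^ 2 ≤ κ ^ 2 * x ^ 2 := by gcongr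
  rw [hw] at h1
  nlinarith [sq_nonneg x]

end JacobiData

namespace JacobiData

variable {n : ℕ} {κ : ℝ} {c a b : ℕ → ℝ}

/-- Of two eigenvalues in the interval `[κ - T ^ 2, κ]` the larger one has the larger sum
`∑ w_j²`, if the head is long and the recurrence is oscillating at most places of the middle
region. -/
theorem sum_wSeq_lt (h : JacobiData n κ c a b) {θ η T r δ : ℝ} {hd : ℕ} (bad : Finset ℕ)
    (x : ℕ → ℝ) (hθ0 : 0 ≤ θ) (hT : κ - θ ≤ T ^ 2) (hT0 : 0 < T) (hr : 0 < r) (hθη : θ + r ≤ η)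
    (hη : η ≤ κ)
    (heig : b (n - 1) * (vPoly c a b (n - 1)).eval θ = (θ - a n) * (vPoly c a b n).eval θ)
    (hhd : 1 ≤ hd) (hhdn : hd ≤ n) (hreg : T ≤ √(b hd) - √(c hd))
    (hδ : 0 < δ) (hδ1 : δ ≤ 1) (hx : ∀ j, |x j| ≤ 1 - δ)
    (hgood : ∀ j, j + 2 ≤ n → |√(b (j + 1)) - √(c (j + 1))| < T → j ∉ bad →
      x (j + 1) = x j ∧ b j = b (j + 1) ∧ c (j + 1) = c (j + 2) ∧
        θ - a (j + 1) = 2 * x j * (√(b (j + 1)) * √(c (j + 1))))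
    (hlarge : (n + 1) * (κ ^ 2 * (2 / δ * (2 * (1 + 2 * κ ^ 2) / δ) ^ bad.card *
      ((1 + 2 * κ ^ 2) * (κ ^ 2 + 1)))) < (1 + r / κ) ^ (2 * hd)) :
    ∑ j ∈ Finset.range (n + 1), wSeq c a b θ j ^ 2 <
      ∑ j ∈ Finset.range (n + 1), wSeq c a b η j ^ 2 := by
  classical
  have hκ := h.one_le
  have hθ : θ ≤ κ := by linarith
  set P : ℕ → Prop := fun i => T ≤ √(b i) - √(c i) with hP
  have hPmono : ∀ i j, i ≤ j → j ≤ n → P j → P i := by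
    intro i j hij hj hPj
    have h1 := Real.sqrt_le_sqrt (h.b_antitone hij hj)
    have h2 := Real.sqrt_le_sqrt (h.c_monotone hij hj)
    simp only [hP] at *
    linarith
  set N := Nat.findGreatest P n with hN
  have hNP : P N := Nat.findGreatest_spec hhdn hreg
  have hhdN : hd ≤ N := Nat.le_findGreatest hhdn hreg
  have hNn : N < n := by
    refine lt_of_le_of_ne (Nat.findGreatest_le n) fun hcon => ?_
    rw [hcon] at hNP
    simp only [hP, h.b_last, Real.sqrt_zero] at hNP
    linarith [Real.sqrt_nonneg (c n)]
  -- The alternative `i = n` provides an end of the middle region when there is no right region.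
  have hexQ : ∃ i, i = n ∨ T ≤ √(c i) - √(b i) := ⟨n, Or.inl rfl⟩
  set M := Nat.find hexQ with hM
  have hMn : M ≤ n := Nat.find_min' hexQ (Or.inl rfl)
  have hNM : N < M := by
    rcases Nat.find_spec hexQ with h1 | h1
    · rw [← hM] at h1; omega
    · rw [← hM] at h1
      by_contra hcon
      have := hPmono M N (not_lt.1 hcon) hNn.le hNP
      simp only [hP] at this
      linarith
  -- the three regions
  have hleft := h.left_region hθ hT hT0.le hNn fun i hi => hPmono i N hi hNn.le hNP
  have hleft' := h.left_region hη (by linarith) hT0.le hNn fun i hi => hPmono i N hi hNn.le hNP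
  have hright : ∀ i, M ≤ i → i ≤ n → wSeq c a b θ i ^ 2 ≤ κ ^ 2 * wSeq c a b θ M ^ 2 := by
    rcases Nat.find_spec hexQ with h1 | h1
    · rw [← hM] at h1
      intro i hi hin
      have : i = M := by omega
      rw [this]
      exact le_mul_of_one_le_left (sq_nonneg _) (one_le_pow₀ hκ)
    · rw [← hM] at h1
      refine h.right_region hθ hT hT0.le heig (by omega) fun i hi hin => ?_
      have h2 := Real.sqrt_le_sqrt (h.b_antitone hi hin)
      have h3 := Real.sqrt_le_sqrt (h.c_monotone hi hin)
      linarith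
  have hmid := energy_growth (w := wSeq c a b θ) (x := x) (δ := δ) (K := 1 + 2 * κ ^ 2) (m := N)
    (N := M - 1) bad hδ hδ1 (by nlinarith) hx
    (fun j _ hj => h.wSeq_step hθ0 hθ (by omega))
    (by
      intro j hNj hjM hb
      have hj2 : j + 2 ≤ n := by omega
      have hmidj : |√(b (j + 1)) - √(c (j + 1))| < T := by
        have h1 : ¬ P (j + 1) := Nat.findGreatest_is_greatest (n := n) (by omega) (by omega)
        have h2 := Nat.find_min hexQ (m := j + 1) (by omega)
        simp only [hP, not_le, not_or] at h1 h2
        rw [abs_lt]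
        constructor <;> linarith [h2.2]
      obtain ⟨e1, e2, e3, e4⟩ := hgood j hj2 hmidj hb
      refine ⟨e1, ?_⟩
      have hw := h.wSeq_add_two θ hj2
      rw [e4, e2, ← e3] at hw
      have hp : 0 < √(b (j + 1)) * √(c (j + 1)) := by
        have p1 : 0 < √(b (j + 1)) :=
          Real.sqrt_pos.2 (one_pos.trans_le (h.b_pos _ (by omega)))
        have p2 : 0 < √(c (j + 1)) :=
          Real.sqrt_pos.2 (one_pos.trans_le (h.c_pos _ (by omega) (by omega)))
        positivity
      refine mul_left_cancel₀ hp.ne' ?_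
      rw [hw]
      ring)
  have hN1 : 1 ≤ N := hhd.trans hhdN
  set W := wSeq c a b θ N ^ 2 with hW
  have hW0 : 0 ≤ W := sq_nonneg _
  have hwpos : ∀ i ≤ N, 0 < wSeq c a b θ i := fun i hi =>
    div_pos (hleft i hi).1 (h.sqrt_kap_pos (by omega))
  have hleftW : ∀ i ≤ N, wSeq c a b θ i ^ 2 ≤ κ ^ 2 * W := by
    intro i hi
    have := pow_le_pow_left₀ (hwpos i hi).le (hleft i hi).2 2
    rwa [mul_pow] at this
  set K := 1 + 2 * κ ^ 2 with hK
  have hK1 : 1 ≤ K := by nlinarith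
  -- Initial energy of the middle region: the pair at `N - 1` and `N` is controlled by growth, and
  -- one further step reaches `N + 1`.
  have hstart : wSeq c a b θ N ^ 2 + wSeq c a b θ (N + 1) ^ 2 ≤ K * (κ ^ 2 + 1) * W := by
    have h1 := h.wSeq_step hθ0 hθ (j := N - 1) (by omega)
    rw [show N - 1 + 1 = N by omega, show N - 1 + 2 = N + 1 by omega] at h1
    have h2 := hleftW (N - 1) (by omega)
    refine h1.trans ?_
    rw [mul_assoc]
    refine mul_le_mul_of_nonneg_left ?_ (by linarith)
    linarith
  set A := 2 / δ * (2 * K / δ) ^ bad.card with hA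
  have hA1 : 1 ≤ A := by
    have h1 : 1 ≤ 2 / δ := by rw [le_div_iff₀ hδ]; linarith
    have h2 : 1 ≤ 2 * K / δ := by rw [le_div_iff₀ hδ]; linarith
    exact one_le_mul_of_one_le_of_one_le h1 (one_le_pow₀ h2)
  have hmidW : ∀ j, N ≤ j → j ≤ M → wSeq c a b θ j ^ 2 ≤ A * (K * (κ ^ 2 + 1)) * W := by
    intro j hNj hjM
    rw [mul_assoc]
    rcases hNj.lt_or_eq with h1 | rfl
    · have h2 := hmid (j - 1) (by omega) (by omega)
      rw [show j - 1 + 1 = j by omega] at h2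
      have h3 : A * (wSeq c a b θ N ^ 2 + wSeq c a b θ (N + 1) ^ 2) ≤
          A * (K * (κ ^ 2 + 1) * W) := by gcongr
      linarith [sq_nonneg (wSeq c a b θ (j - 1))]
    · have h2 : 1 ≤ K * (κ ^ 2 + 1) := by nlinarith
      nlinarith [mul_le_mul hA1 h2 zero_le_one (by linarith)]
  have hall : ∀ j ∈ Finset.range (n + 1),
      wSeq c a b θ j ^ 2 ≤ κ ^ 2 * (A * (K * (κ ^ 2 + 1))) * W := by
    intro j hj
    have hjn : j ≤ n := by simpa [Nat.lt_succ_iff] using hj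
    have hκ2 : 1 ≤ κ ^ 2 := one_le_pow₀ hκ
    have hB : 1 ≤ A * (K * (κ ^ 2 + 1)) :=
      one_le_mul_of_one_le_of_one_le hA1 (one_le_mul_of_one_le_of_one_le hK1 (by linarith))
    rcases le_or_gt j N with h1 | h1
    · refine (hleftW j h1).trans ?_
      have := le_mul_of_one_le_right (by positivity : 0 ≤ κ ^ 2) hB
      gcongr
    · rcases le_or_gt j M with h2 | h2
      · refine (hmidW j h1.le h2).trans ?_
        have := le_mul_of_one_le_left (by linarith : 0 ≤ A * (K * (κ ^ 2 + 1))) hκ2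
        gcongr
      · refine (hright j h2.le hjn).trans ?_
        rw [mul_assoc]
        have := hmidW M hNM.le le_rfl
        gcongr
  have hsum := Finset.sum_le_sum hall
  rw [Finset.sum_const, Finset.card_range, nsmul_eq_mul, ← mul_assoc] at hsum
  push_cast at hsum
  have hcomp : (1 + r / κ) ^ N * wSeq c a b θ N ≤ wSeq c a b η N := by
    have := recurrence_comparison (a := a) (b := b) (c := c)
      (f := fun i => (vPoly c a b i).eval θ) (g := fun i => (vPoly c a b i).eval η) (θ := θ)
      (η := η) (κ := κ) (μ := r / κ) (N := N) (by positivity)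
      (by rw [mul_div_cancel₀ _ (by linarith)]; linarith)
      (eval_vPoly_zero θ) (eval_vPoly_zero η) (h.eval_vPoly_one θ) (h.eval_vPoly_one η)
      (fun i hi => h.eval_vPoly_add_two θ (by omega))
      (fun i hi => h.eval_vPoly_add_two η (by omega))
      (fun i hi => h.b_nonneg (by omega))
      (fun i h1 h2 => one_pos.trans_le (h.c_pos i h1 (by omega)))
      (fun i hi => by linarith [h.a_nonneg i (by omega)])
      (fun i hi => (hleft i hi).1) (fun i hi => (hleft' i hi).1)
    rw [wSeq, wSeq, mul_div_assoc']
    gcongr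
  have hq : 1 ≤ 1 + r / κ := by
    have : 0 < r / κ := by positivity
    linarith
  -- The single term at `N` of the sum for `η` already beats the whole sum for `θ`.
  have hηW : (1 + r / κ) ^ (2 * hd) * W ≤ wSeq c a b η N ^ 2 := by
    have h1 : (1 + r / κ) ^ hd * wSeq c a b θ N ≤ wSeq c a b η N := by
      refine le_trans ?_ hcomp
      refine mul_le_mul_of_nonneg_right (pow_le_pow_right₀ hq hhdN) (hwpos N le_rfl).le
    have h2 := pow_le_pow_left₀ (mul_nonneg (by positivity) (hwpos N le_rfl).le) h1 2
    calc _ = ((1 + r / κ) ^ hd * wSeq c a b θ N) ^ 2 := by rw [hW]; ring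
      _ ≤ _ := h2
  have hWpos : 0 < W := by have := hwpos N le_rfl; positivity
  calc _ ≤ (↑n + 1) * (κ ^ 2 * (A * (K * (κ ^ 2 + 1)))) * W := hsum.trans_eq (by ring)
    _ < (1 + r / κ) ^ (2 * hd) * W := mul_lt_mul_of_pos_right hlarge hWpos
    _ ≤ wSeq c a b η N ^ 2 := hηW
    _ ≤ _ := Finset.single_le_sum (f := fun j => wSeq c a b η j ^ 2) (fun _ _ => sq_nonneg _)
        (by simp; omega)

end JacobiData

/-! ### Counting eigenvalues by approximate eigenvectors -/

open Matrix in
/-- A symmetric matrix with `N` approximate eigenvectors for the value `m`, such that the vectors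
and the error terms have disjoint supports, has `N` eigenvalues near `m`. -/
theorem card_le_card_eigenvalues {ι : Type*} [Fintype ι] [DecidableEq ι] {A : Matrix ι ι ℝ}
    (hA : A.IsHermitian) {N : ℕ} (f g : Fin N → ι → ℝ) (m δ : ℝ) (hδ : 0 ≤ δ)
    (hfg : ∀ k, A *ᵥ f k = m • f k + g k) (hf0 : ∀ k, 0 < ∑ i, f k i ^ 2)
    (hfo : ∀ k l, k ≠ l → ∀ i, f k i * f l i = 0)
    (hgo : ∀ k l, k ≠ l → ∀ i, g k i * g l i = 0)
    (hle : ∀ k, ∑ i, g k i ^ 2 ≤ δ ^ 2 * ∑ i, f k i ^ 2) :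
    N ≤ (Finset.univ.filter fun i => |hA.eigenvalues i - m| ≤ δ).card := by
  classical
  set F := Finset.univ.filter fun i => |hA.eigenvalues i - m| ≤ δ with hF
  by_contra hcon
  push Not at hcon
  set e : ι → ι → ℝ := fun j => (hA.eigenvectorBasis j).ofLp with he
  have parseval : ∀ w : ι → ℝ, ∑ j, (e j ⬝ᵥ w) ^ 2 = ∑ i, w i ^ 2 := by
    intro w
    have h1 := hA.eigenvectorBasis.sum_sq_norm_inner_right (WithLp.toLp 2 w)
    rw [EuclideanSpace.norm_sq_eq] at h1
    simp only [Real.norm_eq_abs, sq_abs, EuclideanSpace.inner_eq_star_dotProduct, star_trivial]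
      at h1
    rw [← h1]
    exact Finset.sum_congr rfl fun j _ => by rw [dotProduct_comm]
  have hsym : ∀ j (w : ι → ℝ), e j ⬝ᵥ (A *ᵥ w) = hA.eigenvalues j * (e j ⬝ᵥ w) := by
    intro j w
    have h1 : A *ᵥ e j = hA.eigenvalues j • e j := hA.mulVec_eigenvectorBasis j
    have h2 : Aᵀ = A := by
      have := hA.eq
      rwa [conjTranspose_eq_transpose_of_trivial] at this
    rw [dotProduct_mulVec, ← mulVec_transpose, h2, h1, smul_dotProduct, smul_eq_mul]
  -- With more vectors `f k` than eigenvalues near `m`, some nonzero combination `w` is orthogonal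
  -- to all eigenvectors for those eigenvalues. Then `A - m` stretches `w` by more than `δ`, whereas
  -- disjoint supports and Pythagoras bound the stretching by `δ`.
  let Φ : (Fin N → ℝ) →ₗ[ℝ] (F → ℝ) := LinearMap.pi fun j =>
    ∑ k, (e j.1 ⬝ᵥ f k) • LinearMap.proj k
  have hker : LinearMap.ker Φ ≠ ⊥ := by
    refine LinearMap.ker_ne_bot_of_finrank_lt ?_
    simp only [Module.finrank_fintype_fun_eq_card, Fintype.card_coe, Fintype.card_fin]
    exact hcon
  obtain ⟨x, hx, hx0⟩ := Submodule.exists_mem_ne_zero_of_ne_bot hker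
  set w : ι → ℝ := ∑ k, x k • f k with hw
  set G : ι → ℝ := ∑ k, x k • g k with hG
  have hAw : A *ᵥ w = m • w + G := by
    rw [hw, hG, mulVec_sum, Finset.smul_sum, ← Finset.sum_add_distrib]
    refine Finset.sum_congr rfl fun k _ => ?_
    rw [mulVec_smul, hfg, smul_add, smul_comm]
  have hwF : ∀ j ∈ F, e j ⬝ᵥ w = 0 := by
    intro j hj
    have h1 := congrFun (LinearMap.mem_ker.1 hx) ⟨j, hj⟩
    simp only [Φ, LinearMap.pi_apply, LinearMap.sum_apply, LinearMap.smul_apply,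
      LinearMap.proj_apply, smul_eq_mul, Pi.zero_apply] at h1
    rw [hw, dotProduct_sum, ← h1]
    refine Finset.sum_congr rfl fun k _ => ?_
    rw [dotProduct_smul, smul_eq_mul, mul_comm]
  have hGw : ∀ j, e j ⬝ᵥ G = (hA.eigenvalues j - m) * (e j ⬝ᵥ w) := by
    intro j
    have h1 := hsym j w
    rw [hAw, dotProduct_add, dotProduct_smul, smul_eq_mul] at h1
    linarith
  have hsq : ∀ (u : Fin N → ι → ℝ), (∀ k l, k ≠ l → ∀ i, u k i * u l i = 0) →
      ∑ i, (∑ k, x k • u k) i ^ 2 = ∑ k, x k ^ 2 * ∑ i, u k i ^ 2 := by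
    intro u hu
    simp only [Finset.mul_sum]
    rw [Finset.sum_comm]
    refine Finset.sum_congr rfl fun i _ => ?_
    rw [Finset.sum_apply, sq, Finset.sum_mul_sum]
    refine Finset.sum_congr rfl fun k _ => ?_
    rw [Finset.sum_eq_single k]
    · simp only [Pi.smul_apply, smul_eq_mul]; ring
    · intro l _ hl
      simp only [Pi.smul_apply, smul_eq_mul]
      linear_combination (x k * x l) * hu k l hl.symm i
    · simp
  have hw2 := hsq f hfo
  have hG2 := hsq g hgo
  have hwpos : 0 < ∑ i, w i ^ 2 := by
    rw [hw, hw2]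
    obtain ⟨k, hk⟩ := Function.ne_iff.1 hx0
    refine Finset.sum_pos' (fun k _ => mul_nonneg (sq_nonneg _) (hf0 k).le)
      ⟨k, Finset.mem_univ _, mul_pos (sq_pos_of_ne_zero hk) (hf0 k)⟩
  have hGle : ∑ i, G i ^ 2 ≤ δ ^ 2 * ∑ i, w i ^ 2 := by
    rw [hw, hG, hw2, hG2, Finset.mul_sum]
    refine Finset.sum_le_sum fun k _ => ?_
    have := mul_le_mul_of_nonneg_left (hle k) (sq_nonneg (x k))
    linarith
  have hlt : δ ^ 2 * ∑ i, w i ^ 2 < ∑ i, G i ^ 2 := by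
    rw [← parseval w, ← parseval G, Finset.mul_sum]
    have hterm : ∀ j, δ ^ 2 * (e j ⬝ᵥ w) ^ 2 ≤ (e j ⬝ᵥ G) ^ 2 ∧
        (e j ⬝ᵥ w ≠ 0 → δ ^ 2 * (e j ⬝ᵥ w) ^ 2 < (e j ⬝ᵥ G) ^ 2) := by
      intro j
      rw [hGw, mul_pow]
      by_cases hj : j ∈ F
      · rw [hwF j hj]; simp
      · have h1 : δ < |hA.eigenvalues j - m| := by
          by_contra h; exact hj (by simp [hF, not_lt.1 h])
        have h2 : δ ^ 2 < (hA.eigenvalues j - m) ^ 2 := by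
          rw [← sq_abs (hA.eigenvalues j - m)]
          exact pow_lt_pow_left₀ h1 hδ two_ne_zero
        exact ⟨mul_le_mul_of_nonneg_right h2.le (sq_nonneg _),
          fun h0 => mul_lt_mul_of_pos_right h2 (by positivity)⟩
    rw [← parseval w] at hwpos
    obtain ⟨j, _, hj⟩ := Finset.exists_ne_zero_of_sum_ne_zero hwpos.ne'
    exact Finset.sum_lt_sum (fun j _ => (hterm j).1)
      ⟨j, Finset.mem_univ _, (hterm j).2 fun h0 => hj (by rw [h0]; norm_num)⟩
  linarith

/-! ### The symmetrised matrix and its simple spectrum -/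

theorem triMatrix_mulVec (n : ℕ) (c a b f : ℕ → ℝ) (i : Fin (n + 1)) :
    ((triMatrix n c a b).mulVec fun j => f j) i =
      (if (i : ℕ) = 0 then 0 else c i * f (i - 1)) + a i * f i +
        (if (i : ℕ) = n then 0 else b i * f (i + 1)) := by
  have h1 : ((triMatrix n c a b).mulVec fun j => f j) i =
      ∑ j ∈ Finset.range (n + 1), ((if j + 1 = (i : ℕ) then c i * f j else 0) +
        (if j = (i : ℕ) then a i * f j else 0) + if j = (i : ℕ) + 1 then b i * f j else 0) := by
    rw [← Fin.sum_univ_eq_sum_range (fun j => ((if j + 1 = (i : ℕ) then c i * f j else 0) +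
        (if j = (i : ℕ) then a i * f j else 0) + if j = (i : ℕ) + 1 then b i * f j else 0))]
    simp only [Matrix.mulVec, dotProduct, triMatrix, Matrix.of_apply]
    refine Finset.sum_congr rfl fun j _ => ?_
    split_ifs <;> first | omega | ring
  rw [h1, Finset.sum_add_distrib, Finset.sum_add_distrib]
  have hi := i.2
  congr 1
  · congr 1
    · split_ifs with h
      · exact Finset.sum_eq_zero fun j _ => if_neg (by omega)
      · rw [Finset.sum_eq_single ((i : ℕ) - 1)]
        · rw [if_pos (by omega)]
        · intro j _ hj; exact if_neg (by omega)
        · intro hj; exact absurd (Finset.mem_range.2 (by omega)) hj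
    · rw [Finset.sum_ite_eq' (Finset.range (n + 1)) (i : ℕ) (fun j => a i * f j),
        if_pos (Finset.mem_range.2 hi)]
  · rw [Finset.sum_ite_eq' (Finset.range (n + 1)) ((i : ℕ) + 1) (fun j => b i * f j)]
    simp only [Finset.mem_range]
    split_ifs <;> first | omega | rfl

/-- The symmetric matrix that is similar to the tridiagonal matrix. -/
noncomputable def symMatrix (n : ℕ) (c a b : ℕ → ℝ) : Matrix (Fin (n + 1)) (Fin (n + 1)) ℝ :=
  triMatrix n (fun i => √(b (i - 1)) * √(c (i - 1 + 1))) a fun i => √(b i) * √(c (i + 1))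

theorem symMatrix_isHermitian (n : ℕ) (c a b : ℕ → ℝ) : (symMatrix n c a b).IsHermitian := by
  ext i j
  simp only [symMatrix, triMatrix, Matrix.conjTranspose_apply, Matrix.of_apply, star_trivial]
  split_ifs <;> first | omega | skip
  all_goals first
    | rfl
    | (congr 3 <;> omega)

namespace JacobiData

variable {n : ℕ} {κ : ℝ} {c a b : ℕ → ℝ}

/-- An eigenvector of the symmetric matrix is a multiple of the vector of the normalised values. -/
theorem eq_wSeq_of_symMatrix_mulVec (h : JacobiData n κ c a b) {θ : ℝ} {f : ℕ → ℝ}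
    (hf : (symMatrix n c a b).mulVec (fun j => f j) = θ • fun j : Fin (n + 1) => f j) :
    (∀ i ≤ n, f i = f 0 * wSeq c a b θ i) ∧
      √(b (n - 1)) * √(c n) * f (n - 1) = (θ - a n) * f n := by
  have hrow : ∀ i, ∀ hi : i < n + 1,
      (if i = 0 then 0 else √(b (i - 1)) * √(c (i - 1 + 1)) * f (i - 1)) + a i * f i +
        (if i = n then 0 else √(b i) * √(c (i + 1)) * f (i + 1)) = θ * f i := by
    intro i hi
    have h1 := congrFun hf ⟨i, hi⟩
    rw [symMatrix, triMatrix_mulVec] at h1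
    simpa using h1
  have hn := h.pos
  have hp : ∀ i < n, √(b i) * √(c (i + 1)) ≠ 0 := by
    intro i hi
    have p1 : 0 < √(b i) := Real.sqrt_pos.2 (one_pos.trans_le (h.b_pos _ hi))
    have p2 : 0 < √(c (i + 1)) :=
      Real.sqrt_pos.2 (one_pos.trans_le (h.c_pos _ (by omega) (by omega)))
    positivity
  constructor
  · have key : ∀ i < n, f i = f 0 * wSeq c a b θ i ∧ f (i + 1) = f 0 * wSeq c a b θ (i + 1) := by
      intro i
      induction i with
      | zero =>
        intro _
        refine ⟨by rw [wSeq_zero, mul_one], ?_⟩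
        have h1 := hrow 0 (by omega)
        rw [if_pos rfl, if_neg (by omega), h.a_zero] at h1
        refine mul_left_cancel₀ (hp 0 hn) ?_
        have h2 := h.wSeq_one θ
        rw [wSeq_zero] at h2
        linear_combination h1 - f 0 * h2
      | succ i ih =>
        intro hi
        obtain ⟨h1, h2⟩ := ih (by omega)
        refine ⟨h2, ?_⟩
        have h3 := hrow (i + 1) (by omega)
        rw [if_neg (by omega), if_neg (by omega), Nat.add_sub_cancel] at h3
        refine mul_left_cancel₀ (hp (i + 1) hi) ?_
        have h4 := h.wSeq_add_two θ (i := i) hi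
        rw [h1, h2] at h3
        rw [show i + 1 + 1 = i + 2 by ring] at *
        linear_combination h3 - f 0 * h4
    intro i hi
    rcases hi.lt_or_eq with h1 | rfl
    · exact (key i h1).1
    · have := (key (i - 1) (by omega)).2
      rwa [Nat.sub_add_cancel hn] at this
  · have h1 := hrow n (by omega)
    rw [if_neg (by omega), if_pos rfl, Nat.sub_add_cancel hn] at h1
    linarith

theorem eval_vPoly_last_of_wSeq (h : JacobiData n κ c a b) {θ : ℝ}
    (hw : √(b (n - 1)) * √(c n) * wSeq c a b θ (n - 1) = (θ - a n) * wSeq c a b θ n) :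
    b (n - 1) * (vPoly c a b (n - 1)).eval θ = (θ - a n) * (vPoly c a b n).eval θ := by
  have hn := h.pos
  have e := h.sqrt_kap_succ (i := n - 1) (by omega)
  rw [Nat.sub_add_cancel hn] at e
  have k0 := h.sqrt_kap_pos (i := n - 1) (by omega)
  have k1 := h.sqrt_kap_pos (i := n) le_rfl
  have hb := Real.mul_self_sqrt (h.b_nonneg (i := n - 1) (by omega))
  have e1 : (vPoly c a b (n - 1)).eval θ = wSeq c a b θ (n - 1) * √(kap c a b (n - 1)) := by
    rw [wSeq]; field_simp
  have e2 : (vPoly c a b n).eval θ = wSeq c a b θ n * √(kap c a b n) := by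
    rw [wSeq]; field_simp
  rw [e1, e2]
  linear_combination √(kap c a b n) * hw - √(b (n - 1)) * wSeq c a b θ (n - 1) * e -
    wSeq c a b θ (n - 1) * √(kap c a b (n - 1)) * hb

/-- A zero of the characteristic equation is an eigenvalue of the tridiagonal matrix. -/
theorem hasEigenvalue_triMatrix (h : JacobiData n κ c a b) {θ : ℝ}
    (heig : b (n - 1) * (vPoly c a b (n - 1)).eval θ = (θ - a n) * (vPoly c a b n).eval θ) :
    Module.End.HasEigenvalue (Matrix.toLin' (triMatrix n c a b)) θ := by
  have hn := h.pos
  -- The `v_i(θ)` satisfy the transposed recurrence; dividing by `κ_i` turns them into a right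
  -- eigenvector.
  set u : ℕ → ℝ := fun i => (vPoly c a b i).eval θ / kap c a b i with hu
  refine Module.End.hasEigenvalue_of_hasEigenvector (x := fun i : Fin (n + 1) => u i) ?_
  rw [Module.End.hasEigenvector_iff]
  constructor
  · rw [Module.End.mem_eigenspace_iff, Matrix.toLin'_apply]
    funext i
    rw [triMatrix_mulVec, Pi.smul_apply, smul_eq_mul]
    have hlow : ∀ j < n, c (j + 1) * u j = b j * (vPoly c a b j).eval θ / kap c a b (j + 1) := by
      intro j hj
      have k0 := h.kap_pos (i := j) (by omega)
      have k1 := h.kap_pos (i := j + 1) (by omega)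
      have e := h.kap_succ hj
      rw [hu]
      beta_reduce
      rw [mul_div_assoc', div_eq_div_iff k0.ne' k1.ne']
      linear_combination (vPoly c a b j).eval θ * e
    have hupp : ∀ j < n, b j * u (j + 1) =
        c (j + 1) * (vPoly c a b (j + 1)).eval θ / kap c a b j := by
      intro j hj
      have k0 := h.kap_pos (i := j) (by omega)
      have k1 := h.kap_pos (i := j + 1) (by omega)
      have e := h.kap_succ hj
      rw [hu]
      beta_reduce
      rw [mul_div_assoc', div_eq_div_iff k1.ne' k0.ne']
      linear_combination -(vPoly c a b (j + 1)).eval θ * e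
    obtain ⟨i, hi⟩ := i
    simp only
    have ki := h.kap_pos (i := i) (by omega)
    rcases Nat.eq_zero_or_pos i with rfl | hi0
    · rw [if_pos rfl, if_neg (by omega), hupp 0 hn, zero_add, zero_add, h.eval_vPoly_one θ]
      simp only [hu]
      ring
    · obtain ⟨j, rfl⟩ : ∃ j, i = j + 1 := ⟨i - 1, by omega⟩
      rw [if_neg (by omega), Nat.add_sub_cancel, hlow j (by omega)]
      by_cases hin : j + 1 = n
      · rw [if_pos hin]
        subst hin
        rw [Nat.add_sub_cancel] at heig
        rw [heig]
        simp only [hu]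
        ring
      · rw [if_neg hin, hupp (j + 1) (by omega), h.eval_vPoly_add_two θ (by omega)]
        simp only [hu]
        ring
  · intro h0
    have := congrFun h0 0
    simp [hu, vPoly, kap] at this

open Matrix in
/-- The eigenvalues of the symmetric matrix are simple and are eigenvalues of the tridiagonal
matrix. -/
theorem symMatrix_eigenvalues (h : JacobiData n κ c a b) :
    Function.Injective (symMatrix_isHermitian n c a b).eigenvalues ∧
    ∀ i, b (n - 1) * (vPoly c a b (n - 1)).eval ((symMatrix_isHermitian n c a b).eigenvalues i) =
      ((symMatrix_isHermitian n c a b).eigenvalues i - a n) *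
        (vPoly c a b n).eval ((symMatrix_isHermitian n c a b).eigenvalues i) := by
  set hA := symMatrix_isHermitian n c a b with hhA
  set e : Fin (n + 1) → Fin (n + 1) → ℝ := fun j => (hA.eigenvectorBasis j).ofLp with he
  set E : Fin (n + 1) → ℕ → ℝ := fun j k => if hk : k < n + 1 then e j ⟨k, hk⟩ else 0 with hE
  have hEe : ∀ j, (fun k : Fin (n + 1) => E j k) = e j := by
    intro j; funext k; exact dif_pos k.2
  have hdot : ∀ j k, e j ⬝ᵥ e k = if j = k then 1 else 0 := by
    intro j k
    have h1 := orthonormal_iff_ite.1 hA.eigenvectorBasis.orthonormal k j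
    rw [EuclideanSpace.inner_eq_star_dotProduct] at h1
    simp only [star_trivial] at h1
    rw [he]
    beta_reduce
    rw [h1]
    simp only [eq_comm]
  have hev : ∀ j, (∀ i ≤ n, E j i = E j 0 * wSeq c a b (hA.eigenvalues j) i) ∧
      √(b (n - 1)) * √(c n) * E j (n - 1) = (hA.eigenvalues j - a n) * E j n := by
    intro j
    refine h.eq_wSeq_of_symMatrix_mulVec ?_
    rw [hEe]
    exact hA.mulVec_eigenvectorBasis j
  have hE0 : ∀ j, E j 0 ≠ 0 := by
    intro j h0
    have h1 : e j = 0 := by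
      rw [← hEe]
      funext k
      rw [(hev j).1 k (by omega), h0, zero_mul]; rfl
    have h2 := hdot j j
    rw [h1] at h2
    simp at h2
  constructor
  · intro i j hij
    by_contra hne
    have h1 := hdot i j
    rw [if_neg hne, ← hEe, ← hEe, dotProduct] at h1
    -- Two eigenvectors for one eigenvalue would both be nonzero multiples of the vector of the
    -- `w_k`, so they could not be orthogonal.
    have h2 : ∑ k : Fin (n + 1), E i k * E j k =
        E i 0 * E j 0 * ∑ k ∈ Finset.range (n + 1), wSeq c a b (hA.eigenvalues i) k ^ 2 := by
      rw [Fin.sum_univ_eq_sum_range (fun k => E i k * E j k), Finset.mul_sum]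
      refine Finset.sum_congr rfl fun k hk => ?_
      have hk : k ≤ n := by simpa [Nat.lt_succ_iff] using hk
      rw [(hev i).1 k hk, (hev j).1 k hk, ← hij]
      ring
    rw [h2] at h1
    exact mul_ne_zero (mul_ne_zero (hE0 i) (hE0 j)) (sum_wSeq_pos _).ne' h1
  · intro j
    refine h.eval_vPoly_last_of_wSeq ?_
    obtain ⟨h1, h2⟩ := hev j
    rw [h1 (n - 1) (Nat.sub_le _ _), h1 n le_rfl] at h2
    refine mul_left_cancel₀ (hE0 j) ?_
    linear_combination h2

end JacobiData

/-! ### Sine windows in a constant block -/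

/-- The truncated sine sequence. -/
noncomputable def sineWindow (φ : ℝ) (K t : ℕ) : ℝ :=
  if 1 ≤ t ∧ t ≤ K then Real.sin (t * φ) else 0

/-- Since `sin φ` is the sine of the difference of two consecutive arguments, the squares of two
consecutive terms add up to at least `sin² φ / 2`. Summing over neighbouring pairs counts each term
at most twice. -/
theorem sineWindow_sq_sum (φ : ℝ) (K : ℕ) :
    K * Real.sin φ ^ 2 / 4 ≤ ∑ t ∈ Finset.range (K + 1), sineWindow φ K t ^ 2 := by
  have hy : ∀ t ≤ K, sineWindow φ K t = Real.sin (t * φ) := by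
    intro t ht
    unfold sineWindow
    split_ifs with h
    · rfl
    · have : t = 0 := by omega
      simp [this]
  have hpair : ∀ t ∈ Finset.range K,
      Real.sin φ ^ 2 / 2 ≤ sineWindow φ K t ^ 2 + sineWindow φ K (t + 1) ^ 2 := by
    intro t ht
    rw [Finset.mem_range] at ht
    rw [hy t ht.le, hy (t + 1) ht]
    have e : Real.sin φ = Real.sin (((t + 1 : ℕ) : ℝ) * φ) * Real.cos (t * φ) -
        Real.cos (((t + 1 : ℕ) : ℝ) * φ) * Real.sin (t * φ) := by
      rw [← Real.sin_sub]; congr 1; push_cast; ring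
    have c1 := Real.sin_sq_add_cos_sq (((t + 1 : ℕ) : ℝ) * φ)
    have c2 := Real.sin_sq_add_cos_sq ((t : ℝ) * φ)
    set s1 := Real.sin (((t + 1 : ℕ) : ℝ) * φ)
    set s0 := Real.sin ((t : ℝ) * φ)
    set k1 := Real.cos (((t + 1 : ℕ) : ℝ) * φ)
    set k0 := Real.cos ((t : ℝ) * φ)
    rw [e]
    have h1 : (s1 * k0) ^ 2 ≤ s1 ^ 2 := by
      rw [mul_pow]; nlinarith [sq_nonneg s0, sq_nonneg s1]
    have h2 : (k1 * s0) ^ 2 ≤ s0 ^ 2 := by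
      rw [mul_pow]; nlinarith [sq_nonneg s0, sq_nonneg s1]
    nlinarith [sq_nonneg (s1 * k0 + k1 * s0)]
  have h1 := Finset.sum_le_sum hpair
  rw [Finset.sum_const, Finset.card_range, nsmul_eq_mul, Finset.sum_add_distrib] at h1
  have h2 := Finset.sum_range_succ (fun t => sineWindow φ K t ^ 2) K
  have h3 := Finset.sum_range_succ' (fun t => sineWindow φ K t ^ 2) K
  have h4 := sq_nonneg (sineWindow φ K K)
  have h5 := sq_nonneg (sineWindow φ K 0)
  linarith

theorem sineWindow_of_le (φ : ℝ) {K t : ℕ} (ht : t ≤ K) :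
    sineWindow φ K t = Real.sin (t * φ) := by
  unfold sineWindow
  split_ifs with h
  · rfl
  · have : t = 0 := by omega
    simp [this]

theorem sineWindow_of_lt (φ : ℝ) {K t : ℕ} (ht : K < t) : sineWindow φ K t = 0 :=
  if_neg (by omega)

theorem sineWindow_zero (φ : ℝ) (K : ℕ) : sineWindow φ K 0 = 0 := if_neg (by omega)

theorem sin_three_term (φ : ℝ) (t : ℕ) :
    Real.sin (t * φ) + Real.sin ((t + 2 : ℕ) * φ) =
      2 * Real.cos φ * Real.sin ((t + 1 : ℕ) * φ) := by
  have h1 : ((t : ℕ) : ℝ) * φ = (t + 1 : ℕ) * φ - φ := by push_cast; ring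
  have h2 : ((t + 2 : ℕ) : ℝ) * φ = (t + 1 : ℕ) * φ + φ := by push_cast; ring
  rw [h1, h2, Real.sin_sub, Real.sin_add]
  ring

/-- The sine sequence on a window satisfies the three-term recurrence up to three places. -/
theorem sineWindow_defect (φ : ℝ) {K : ℕ} (hK : 1 ≤ K) (t : ℕ) :
    ((if t = 0 then 0 else sineWindow φ K (t - 1)) - 2 * Real.cos φ * sineWindow φ K t +
      sineWindow φ K (t + 1)) ^ 2 ≤ if t = 0 ∨ t = K ∨ t = K + 1 then 1 else 0 := by
  have hs : ∀ x : ℝ, Real.sin x ^ 2 ≤ 1 := Real.sin_sq_le_one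
  rcases Nat.eq_zero_or_pos t with rfl | ht
  · rw [if_pos rfl, if_pos (Or.inl rfl), sineWindow_zero, sineWindow_of_le φ hK]
    simpa using hs φ
  · obtain ⟨u, rfl⟩ : ∃ u, t = u + 1 := ⟨t - 1, by omega⟩
    rw [if_neg (by omega), Nat.add_sub_cancel]
    have h3 := sin_three_term φ u
    rcases lt_trichotomy (u + 1) K with h | h | h
    · rw [sineWindow_of_le φ (by omega : u ≤ K), sineWindow_of_le φ h.le,
        sineWindow_of_le φ (by omega : u + 1 + 1 ≤ K), if_neg (by omega)]
      rw [← h3, show u + 1 + 1 = u + 2 by ring]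
      simp
    · rw [sineWindow_of_le φ (by omega : u ≤ K), sineWindow_of_le φ h.le,
        sineWindow_of_lt φ (by omega : K < u + 1 + 1), if_pos (by omega), ← h3]
      have := hs ((u + 2 : ℕ) * φ)
      calc _ = Real.sin ((u + 2 : ℕ) * φ) ^ 2 := by ring
        _ ≤ 1 := this
    · rw [sineWindow_of_lt φ h, sineWindow_of_lt φ (by omega : K < u + 1 + 1)]
      by_cases h5 : u = K
      · rw [if_pos (by omega), sineWindow_of_le φ h5.le]
        simpa using hs (u * φ)
      · rw [sineWindow_of_lt φ (by omega : K < u), if_neg (by omega)]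
        simp

/-- The sine window placed at `o`. -/
noncomputable def shiftedWindow (φ : ℝ) (K o i : ℕ) : ℝ :=
  if o ≤ i then sineWindow φ K (i - o) else 0

theorem shiftedWindow_add (φ : ℝ) (K o t : ℕ) :
    shiftedWindow φ K o (o + t) = sineWindow φ K t := by
  rw [shiftedWindow, if_pos (by omega), Nat.add_sub_cancel_left]

theorem shiftedWindow_eq_zero (φ : ℝ) {K o i : ℕ} (hi : i ≤ o ∨ o + K < i) :
    shiftedWindow φ K o i = 0 := by
  unfold shiftedWindow
  split_ifs with h
  · rcases hi with h1 | h1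
    · rw [show i - o = 0 by omega, sineWindow_zero]
    · exact sineWindow_of_lt φ (by omega)
  · rfl

/-- The error of the shifted window as an approximate eigenvector. -/
noncomputable def windowDefect (n : ℕ) (c a b : ℕ → ℝ) (m φ : ℝ) (K o i : ℕ) : ℝ :=
  (if i = 0 then 0 else √(b (i - 1)) * √(c (i - 1 + 1)) * shiftedWindow φ K o (i - 1)) +
    a i * shiftedWindow φ K o i +
    (if i = n then 0 else √(b i) * √(c (i + 1)) * shiftedWindow φ K o (i + 1)) -
    m * shiftedWindow φ K o i

theorem windowDefect_eq_zero (n : ℕ) (c a b : ℕ → ℝ) (m φ : ℝ) {K o i : ℕ} (ho : 1 ≤ o)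
    (hi : i < o ∨ o + K + 1 < i) : windowDefect n c a b m φ K o i = 0 := by
  unfold windowDefect
  rw [shiftedWindow_eq_zero φ (by omega : i ≤ o ∨ o + K < i),
    shiftedWindow_eq_zero φ (by omega : i - 1 ≤ o ∨ o + K < i - 1),
    shiftedWindow_eq_zero φ (by omega : i + 1 ≤ o ∨ o + K < i + 1)]
  simp

/-- In the rows `o` and `o + K + 1` one off-diagonal entry may involve data from outside the block,
but there it multiplies a zero of the window. -/
theorem windowDefect_sq_le {n : ℕ} {c a b : ℕ → ℝ} {m φ α β γ : ℝ} {K o : ℕ} (hK : 1 ≤ K)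
    (ho : 1 ≤ o) (hon : o + K + 1 < n)
    (hblock : ∀ i, o ≤ i → i ≤ o + K + 1 → b i = β ∧ c i = γ ∧ a i = α)
    (hm : m = α + 2 * (√β * √γ) * Real.cos φ) {t : ℕ} (ht : t ≤ K + 1) :
    windowDefect n c a b m φ K o (o + t) ^ 2 ≤
      (√β * √γ) ^ 2 * if t = 0 ∨ t = K ∨ t = K + 1 then 1 else 0 := by
  have h1 : windowDefect n c a b m φ K o (o + t) = (√β * √γ) *
      ((if t = 0 then 0 else sineWindow φ K (t - 1)) - 2 * Real.cos φ * sineWindow φ K t +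
      sineWindow φ K (t + 1)) := by
    unfold windowDefect
    rw [if_neg (by omega : ¬ o + t = 0), if_neg (by omega : ¬ o + t = n), shiftedWindow_add,
      show o + t + 1 = o + (t + 1) by ring, shiftedWindow_add, (hblock (o + t) (by omega)
      (by omega)).2.2, (hblock (o + t) (by omega) (by omega)).1, hm]
    have hlow : √(b (o + t - 1)) * √(c (o + t - 1 + 1)) * shiftedWindow φ K o (o + t - 1) =
        √β * √γ * (if t = 0 then 0 else sineWindow φ K (t - 1)) := by
      split_ifs with h
      · rw [shiftedWindow_eq_zero φ (by omega)]; ring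
      · rw [show o + t - 1 = o + (t - 1) by omega, shiftedWindow_add,
          (hblock (o + (t - 1)) (by omega) (by omega)).1,
          (hblock (o + (t - 1) + 1) (by omega) (by omega)).2.1]
    rw [hlow]
    rcases ht.lt_or_eq with h | h
    · rw [(hblock (o + (t + 1)) (by omega) (by omega)).2.1]
      ring
    · rw [sineWindow_of_lt φ (by omega : K < t + 1), sineWindow_of_lt φ (by omega : K < t)]
      ring
  rw [h1, mul_pow]
  exact mul_le_mul_of_nonneg_left (sineWindow_defect φ hK t) (sq_nonneg _)

/-- A long constant block produces proportionally many eigenvalues near each point of its interval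
of oscillation. -/
theorem exists_eigenvalues_of_block {α β γ m δ : ℝ}
    (hm : |m - α| < 2 * (√β * √γ)) (hδ : 0 < δ) :
    ∃ K : ℕ, ∀ (n : ℕ) (κ : ℝ) (c a b : ℕ → ℝ), JacobiData n κ c a b →
      ∀ s l : ℕ, 1 ≤ s → s + l ≤ n →
        (∀ i, s ≤ i → i < s + l → b i = β ∧ c i = γ ∧ a i = α) →
        ∃ E : Finset ℝ, l / (K + 2) ≤ E.card ∧ ∀ θ ∈ E, |θ - m| ≤ δ ∧
          b (n - 1) * (vPoly c a b (n - 1)).eval θ = (θ - a n) * (vPoly c a b n).eval θ := by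
  classical
  set p := √β * √γ with hp
  have hp0 : 0 < p := by linarith [abs_nonneg (m - α)]
  set φ := Real.arccos ((m - α) / (2 * p)) with hφ
  have habs : |(m - α) / (2 * p)| < 1 := by
    rw [abs_div, abs_of_pos (by linarith : 0 < 2 * p), div_lt_one (by linarith)]
    exact hm
  obtain ⟨hl, hu⟩ := abs_lt.1 habs
  have hcos : Real.cos φ = (m - α) / (2 * p) := Real.cos_arccos hl.le hu.le
  have hmφ : m = α + 2 * p * Real.cos φ := by rw [hcos]; field_simp; ring
  have hsin : 0 < Real.sin φ ^ 2 := by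
    have h1 := Real.sin_sq_add_cos_sq φ
    rw [hcos] at h1
    have h2 : ((m - α) / (2 * p)) ^ 2 < 1 := by
      rw [← sq_abs]; exact pow_lt_one₀ (abs_nonneg _) habs two_ne_zero
    linarith
  -- The error of a window has at most three nonzero entries of size at most `p`, while its squared
  -- norm is at least `K * sin² φ / 4`; so a window length depending only on the block and on `δ` is
  -- enough.
  obtain ⟨K0, hK0⟩ := exists_nat_ge (3 * p ^ 2 / (δ ^ 2 * (Real.sin φ ^ 2 / 4)))
  set K := K0 + 1 with hK
  have hKb : 3 * p ^ 2 ≤ δ ^ 2 * (K * Real.sin φ ^ 2 / 4) := by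
    rw [div_le_iff₀ (by positivity)] at hK0
    have : (K : ℝ) = K0 + 1 := by rw [hK]; push_cast; ring
    rw [this]
    nlinarith [mul_pos (pow_pos hδ 2) hsin]
  refine ⟨K, fun n κ c a b h s l hs hsl hblock => ?_⟩
  set N := l / (K + 2) with hN
  have hNl : N * (K + 2) ≤ l := Nat.div_mul_le_self _ _
  -- The error of the window at `o` can be nonzero on `o, ..., o + K + 1`, whence the spacing `K +
  -- 2`.
  set o : Fin N → ℕ := fun k => s + k * (K + 2) with ho
  have hok : ∀ k : Fin N, o k + K + 1 < s + l := by
    intro k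
    have h1 : (k + 1) * (K + 2) ≤ N * (K + 2) := Nat.mul_le_mul_right _ k.2
    have h2 : ((k : ℕ) + 1) * (K + 2) = k * (K + 2) + (K + 2) := by ring
    simp only [ho]
    omega
  have hsep : ∀ k l : Fin N, k ≠ l → ∀ i, (i < o k ∨ o k + K + 1 < i) ∨
      (i < o l ∨ o l + K + 1 < i) := by
    intro k l hkl i
    have hne : (k : ℕ) ≠ l := fun hh => hkl (Fin.ext hh)
    rcases lt_or_gt_of_ne hne with h1 | h1
    · have h2 : (k + 1) * (K + 2) ≤ l * (K + 2) := Nat.mul_le_mul_right _ h1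
      have h3 : ((k : ℕ) + 1) * (K + 2) = k * (K + 2) + (K + 2) := by ring
      simp only [ho]
      omega
    · have h2 : (l + 1) * (K + 2) ≤ k * (K + 2) := Nat.mul_le_mul_right _ h1
      have h3 : ((l : ℕ) + 1) * (K + 2) = l * (K + 2) + (K + 2) := by ring
      simp only [ho]
      omega
  have ho1 : ∀ k, 1 ≤ o k := fun k => by simp only [ho]; omega
  have hflow : ∀ k, K * Real.sin φ ^ 2 / 4 ≤
      ∑ i : Fin (n + 1), shiftedWindow φ K (o k) i ^ 2 := by
    intro k
    have hk := hok k
    rw [Fin.sum_univ_eq_sum_range (fun i => shiftedWindow φ K (o k) i ^ 2)]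
    refine (sineWindow_sq_sum φ K).trans ?_
    have h1 : ∑ i ∈ Finset.Ico (o k) (o k + (K + 1)), shiftedWindow φ K (o k) i ^ 2 =
        ∑ t ∈ Finset.range (K + 1), sineWindow φ K t ^ 2 := by
      rw [Finset.sum_Ico_eq_sum_range, Nat.add_sub_cancel_left]
      exact Finset.sum_congr rfl fun t _ => by rw [shiftedWindow_add]
    rw [← h1]
    refine Finset.sum_le_sum_of_subset_of_nonneg ?_ fun _ _ _ => sq_nonneg _
    intro i hi
    rw [Finset.mem_Ico] at hi
    exact Finset.mem_range.2 (by omega)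
  have hcard := card_le_card_eigenvalues (symMatrix_isHermitian n c a b)
    (fun k (i : Fin (n + 1)) => shiftedWindow φ K (o k) i)
    (fun k (i : Fin (n + 1)) => windowDefect n c a b m φ K (o k) i) m δ hδ.le
    (by
      intro k
      funext i
      rw [symMatrix, triMatrix_mulVec]
      simp only [Pi.add_apply, Pi.smul_apply, smul_eq_mul, windowDefect]
      ring)
    (by
      intro k
      refine lt_of_lt_of_le ?_ (hflow k)
      have : (0 : ℝ) < K := by rw [hK]; positivity
      positivity)
    (by
      intro k l hkl i
      rcases hsep k l hkl i with h1 | h1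
      · rw [shiftedWindow_eq_zero φ (o := o k) (by omega), zero_mul]
      · rw [shiftedWindow_eq_zero φ (o := o l) (by omega), mul_zero])
    (by
      intro k l hkl i
      rcases hsep k l hkl i with h1 | h1
      · rw [windowDefect_eq_zero n c a b m φ (ho1 k) h1, zero_mul]
      · rw [windowDefect_eq_zero n c a b m φ (ho1 l) h1, mul_zero])
    (by
      intro k
      have hk := hok k
      refine le_trans ?_ (mul_le_mul_of_nonneg_left (hflow k) (sq_nonneg δ))
      refine le_trans ?_ hKb
      rw [Fin.sum_univ_eq_sum_range (fun i => windowDefect n c a b m φ K (o k) i ^ 2)]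
      have h1 : ∑ i ∈ Finset.range (n + 1), windowDefect n c a b m φ K (o k) i ^ 2 =
          ∑ t ∈ Finset.range (K + 2), windowDefect n c a b m φ K (o k) (o k + t) ^ 2 := by
        have h2 := Finset.sum_Ico_eq_sum_range
          (fun i => windowDefect n c a b m φ K (o k) i ^ 2) (o k) (o k + (K + 2))
        rw [Nat.add_sub_cancel_left] at h2
        rw [← h2]
        symm
        refine Finset.sum_subset ?_ ?_
        · intro i hi
          rw [Finset.mem_Ico] at hi
          exact Finset.mem_range.2 (by omega)
        · intro i _ hi
          rw [Finset.mem_Ico] at hi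
          rw [windowDefect_eq_zero n c a b m φ (ho1 k) (by omega)]
          norm_num
      rw [h1]
      have h3 : ∀ t ∈ Finset.range (K + 2), windowDefect n c a b m φ K (o k) (o k + t) ^ 2 ≤
          p ^ 2 * if t = 0 ∨ t = K ∨ t = K + 1 then 1 else 0 := by
        intro t ht
        rw [Finset.mem_range] at ht
        refine windowDefect_sq_le (by omega) (ho1 k) (by omega) (fun i h1 h2 => ?_) hmφ (by omega)
        exact hblock i (by simp only [ho] at h1; omega) (by omega)
      refine (Finset.sum_le_sum h3).trans ?_
      rw [← Finset.mul_sum, mul_comm (3 : ℝ)]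
      refine mul_le_mul_of_nonneg_left ?_ (sq_nonneg _)
      rw [Finset.sum_ite, Finset.sum_const_zero, add_zero, Finset.sum_const, nsmul_eq_mul, mul_one]
      have h4 : ((Finset.range (K + 2)).filter fun t => t = 0 ∨ t = K ∨ t = K + 1) ⊆
          {0, K, K + 1} := by
        intro t ht
        simpa using (Finset.mem_filter.1 ht).2
      have h5 := (Finset.card_le_card h4).trans Finset.card_le_three
      exact_mod_cast h5)
  obtain ⟨hinj, heig⟩ := h.symMatrix_eigenvalues
  refine ⟨(Finset.univ.filter fun i =>
    |(symMatrix_isHermitian n c a b).eigenvalues i - m| ≤ δ).image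
      (symMatrix_isHermitian n c a b).eigenvalues, ?_, ?_⟩
  · rw [Finset.card_image_of_injective _ hinj]
    exact hcard
  · intro θ hθ
    obtain ⟨i, hi, rfl⟩ := Finset.mem_image.1 hθ
    exact ⟨(Finset.mem_filter.1 hi).2, heig i⟩

/-! ### Blocks of tridiagonal sequences -/

theorem start_zero {g : ℕ} (ell : Fin (g + 1) → ℕ) : start ell 0 = 1 := by
  have : Finset.Iio (0 : Fin (g + 1)) = ∅ := by ext i; simp
  rw [start, this, Finset.sum_empty, add_zero]

theorem start_succ {g : ℕ} (ell : Fin (g + 1) → ℕ) (i : Fin g) :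
    start ell i.succ = start ell i.castSucc + ell i.castSucc := by
  have h : Finset.Iio i.succ = insert i.castSucc (Finset.Iio i.castSucc) := by
    ext j
    simp only [Finset.mem_Iio, Finset.mem_insert, Fin.lt_def, Fin.ext_iff, Fin.val_succ,
      Fin.val_castSucc]
    omega
  unfold start
  rw [h, Finset.sum_insert (by simp)]
  ring

theorem exists_block {g : ℕ} (ell : Fin (g + 1) → ℕ) (i : Fin (g + 1)) {m : ℕ} (h1 : 1 ≤ m)
    (h2 : m < start ell i + ell i) :
    ∃ k ≤ i, start ell k ≤ m ∧ m < start ell k + ell k := by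
  induction i using Fin.induction with
  | zero => exact ⟨0, le_rfl, by rw [start_zero]; exact h1, h2⟩
  | succ i ih =>
    rcases lt_or_ge m (start ell i.succ) with h | h
    · rw [start_succ] at h
      obtain ⟨k, hk, hk'⟩ := ih h
      exact ⟨k, hk.trans (Fin.castSucc_lt_succ).le, hk'⟩
    · exact ⟨i.succ, le_rfl, h, h2⟩

theorem tdSeq_of_mem {g : ℕ} (G : Fin (g + 1) → ℕ × ℕ × ℕ) (ell : Fin (g + 1) → ℕ)
    {i : Fin (g + 1)} {m : ℕ} (h1 : start ell i ≤ m) (h2 : m < start ell i + ell i) :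
    tdSeq G ell m = G i := by
  have := tdSeq_start_add G ell i (m - start ell i) (by omega)
  rwa [Nat.add_sub_cancel' h1] at this

/-- This default value gives `c 0 = 0`, so that row `0` has the same row sum as the others. -/
theorem tdSeq_zero {g : ℕ} (G : Fin (g + 1) → ℕ × ℕ × ℕ) (ell : Fin (g + 1) → ℕ) :
    tdSeq G ell 0 = 0 := by
  unfold tdSeq
  refine Finset.sum_eq_zero fun i _ => if_neg ?_
  rw [start]
  omega

theorem diam_eq_sum {g : ℕ} (ell : Fin (g + 1) → ℕ) (hl : ell (Fin.last g) = 1) :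
    diam ell = ∑ i, ell i := by
  have h : (Finset.univ : Finset (Fin (g + 1))) =
      insert (Fin.last g) (Finset.Iio (Fin.last g)) := by
    ext j
    simp only [Finset.mem_univ, Finset.mem_insert, Finset.mem_Iio, true_iff]
    exact (Fin.le_last j).eq_or_lt
  rw [h, Finset.sum_insert (by simp), hl, diam, start]

theorem start_add_le_diam {g : ℕ} (ell : Fin (g + 1) → ℕ) {i : Fin (g + 1)}
    (hi : i ≠ Fin.last g) : start ell i + ell i ≤ diam ell :=
  start_add_le ell ((Fin.le_last i).lt_of_ne hi)

namespace IsGraphicalSequence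

variable {κ lam g : ℕ} {G : Fin (g + 1) → ℕ × ℕ × ℕ}

theorem gamma_monotone (hG : IsGraphicalSequence κ lam G) : Monotone fun i => (G i).1 :=
  Fin.monotone_iff_le_succ.2 fun i => hG.gamma_mono i.castSucc i.succ (by simp)

theorem beta_antitone (hG : IsGraphicalSequence κ lam G) : Antitone fun i => (G i).2.2 := by
  refine Fin.antitone_iff_succ_le.2 fun i => ?_
  rcases (Nat.succ_le_of_lt i.2).lt_or_eq with h | h
  · exact hG.beta_anti i.castSucc i.succ (by simp) (by simpa using h)
  · have : i.succ = Fin.last g := Fin.ext (by simpa using h)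
    rw [this, hG.beta_last]
    exact Nat.zero_le _

theorem one_le_gamma (hG : IsGraphicalSequence κ lam G) (i : Fin (g + 1)) : 1 ≤ (G i).1 := by
  have := hG.gamma_monotone (Fin.zero_le i)
  simp only [hG.first] at this
  exact this

theorem sum_eq (hG : IsGraphicalSequence κ lam G) (i : Fin (g + 1)) :
    (G i).1 + (G i).2.1 + (G i).2.2 = κ := by
  rcases (Nat.le_of_lt_succ i.2).lt_or_eq with h | h
  · exact (hG.mem_V i h).2.2.1
  · have : i = Fin.last g := Fin.ext h
    rw [this, hG.beta_last, hG.sum_last, add_zero]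

theorem one_le_beta (hG : IsGraphicalSequence κ lam G) {i : Fin (g + 1)} (hi : i ≠ Fin.last g) :
    1 ≤ (G i).2.2 :=
  (hG.mem_V i (Fin.val_lt_last hi)).1

theorem jacobiData (hG : IsGraphicalSequence κ lam G) (hκ : 1 ≤ κ) {ell : Fin (g + 1) → ℕ}
    (hpos : ∀ i, 1 ≤ ell i) (hlast : ell (Fin.last g) = 1) :
    JacobiData (diam ell) κ (cSeq G ell) (aSeq G ell) (bSeq κ G ell) := by
  have hblock : ∀ m, 1 ≤ m → m ≤ diam ell → ∃ i, start ell i ≤ m ∧ m < start ell i + ell i := by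
    intro m h1 h2
    obtain ⟨k, _, hk⟩ := exists_block ell (Fin.last g) h1 (by rw [hlast]; unfold diam at h2; omega)
    exact ⟨k, hk⟩
  have hmono : ∀ m, 1 ≤ m → m < diam ell →
      (tdSeq G ell m).1 ≤ (tdSeq G ell (m + 1)).1 ∧
        (tdSeq G ell (m + 1)).2.2 ≤ (tdSeq G ell m).2.2 := by
    intro m h1 h2
    obtain ⟨i, hi1, hi2⟩ := hblock m h1 h2.le
    obtain ⟨j, hj1, hj2⟩ := hblock (m + 1) (by omega) h2
    have hij : i ≤ j := by
      by_contra hcon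
      have := start_add_le ell (not_le.1 hcon)
      omega
    rw [tdSeq_of_mem G ell hi1 hi2, tdSeq_of_mem G ell hj1 hj2]
    exact ⟨hG.gamma_monotone hij, hG.beta_antitone hij⟩
  have hc : ∀ m, 1 ≤ m → m ≤ diam ell → 1 ≤ (tdSeq G ell m).1 := by
    intro m h1 h2
    obtain ⟨i, hi1, hi2⟩ := hblock m h1 h2
    rw [tdSeq_of_mem G ell hi1 hi2]
    exact hG.one_le_gamma i
  have hsum : ∀ m, 1 ≤ m → m ≤ diam ell →
      (tdSeq G ell m).1 + (tdSeq G ell m).2.1 + (tdSeq G ell m).2.2 = κ := by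
    intro m h1 h2
    obtain ⟨i, hi1, hi2⟩ := hblock m h1 h2
    rw [tdSeq_of_mem G ell hi1 hi2]
    exact hG.sum_eq i
  have hd : 1 ≤ diam ell := by unfold diam start; omega
  refine ⟨hd, ?_, ?_, ?_, ?_, ?_, ?_, ?_, ?_, ?_, ?_⟩
  · intro m hm
    rcases Nat.eq_zero_or_pos m with rfl | h0
    · simp [cSeq, aSeq, bSeq, tdSeq_zero]
    · simp only [cSeq, aSeq, bSeq, if_neg h0.ne']
      exact_mod_cast hsum m h0 hm
  · simp [cSeq, tdSeq_zero]
  · simp [aSeq]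
  · have := tdSeq_of_mem G ell (i := 0) (m := 1) (start_zero ell).le
      (by rw [start_zero]; have := hpos 0; omega)
    simp [cSeq, this, hG.first]
  · have := tdSeq_of_mem G ell (i := Fin.last g) (m := diam ell) le_rfl
      (by rw [hlast]; unfold diam; omega)
    simp only [bSeq, if_neg (by omega : ¬ diam ell = 0)]
    rw [this, hG.beta_last, Nat.cast_zero]
  · intro m hm
    rcases Nat.eq_zero_or_pos m with rfl | h0
    · simp only [bSeq, if_true]
      exact_mod_cast hκ
    · obtain ⟨i, hi1, hi2⟩ := hblock m h0 hm.le
      have hil : i ≠ Fin.last g := by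
        rintro rfl
        unfold diam at hm
        omega
      simp only [bSeq, if_neg h0.ne', tdSeq_of_mem G ell hi1 hi2]
      exact_mod_cast hG.one_le_beta hil
  · intro m h1 h2
    simp only [cSeq]
    exact_mod_cast hc m h1 h2
  · intro m _
    simp only [aSeq]
    split_ifs <;> positivity
  · intro m hm
    rcases Nat.eq_zero_or_pos m with rfl | h0
    · simp only [bSeq, if_true, if_neg (by omega : ¬ 0 + 1 = 0)]
      have := hsum (0 + 1) le_rfl hd
      exact_mod_cast (by omega : (tdSeq G ell (0 + 1)).2.2 ≤ κ)
    · simp only [bSeq, if_neg h0.ne', if_neg (by omega : ¬ m + 1 = 0)]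
      exact_mod_cast (hmono m h0 hm).2
  · intro m hm
    rcases Nat.eq_zero_or_pos m with rfl | h0
    · simp [cSeq, tdSeq_zero]
    · simp only [cSeq]
      exact_mod_cast (hmono m h0 hm).1

end IsGraphicalSequence

/-! ### The characteristic polynomial over the integers -/

/-- A tridiagonal matrix with integer entries has a monic integer characteristic polynomial whose
roots are bounded by the row sum. -/
theorem JacobiData.exists_int_polynomial {n : ℕ} {κ : ℝ} {c a b : ℕ → ℝ}
    (h : JacobiData n κ c a b) (c' a' b' : ℕ → ℤ) (hc : ∀ i, c i = c' i) (ha : ∀ i, a i = a' i)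
    (hb : ∀ i, b i = b' i) :
    ∃ P : ℤ[X], P.Monic ∧ P.natDegree = n + 1 ∧
      (∀ z ∈ (P.map (Int.castRingHom ℂ)).roots, ‖z‖ ≤ κ) ∧
      ∀ θ : ℝ, Module.End.HasEigenvalue (Matrix.toLin' (triMatrix n c a b)) θ →
        aeval θ P = 0 := by
  classical
  set A : Matrix (Fin (n + 1)) (Fin (n + 1)) ℤ := Matrix.of fun i j =>
    if (j : ℕ) + 1 = i then c' i
    else if (j : ℕ) = i then a' i
    else if (j : ℕ) = i + 1 then b' i
    else 0 with hA
  have hAr : A.map (Int.castRingHom ℝ) = triMatrix n c a b := by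
    ext i j
    simp only [hA, triMatrix, Matrix.map_apply, Matrix.of_apply, hc, ha, hb]
    split_ifs <;> simp
  have hentry : ∀ i j, 0 ≤ triMatrix n c a b i j := by
    intro i j
    simp only [triMatrix, Matrix.of_apply]
    have hi : (i : ℕ) ≤ n := by omega
    split_ifs
    · exact h.c_nonneg hi
    · exact h.a_nonneg _ hi
    · exact h.b_nonneg hi
    · exact le_rfl
  have hrow : ∀ i, ∑ j, triMatrix n c a b i j ≤ κ := by
    intro i
    have h1 := triMatrix_mulVec n c a b (fun _ => 1) i
    simp only [Matrix.mulVec, dotProduct, mul_one] at h1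
    have hi : (i : ℕ) ≤ n := by omega
    have h2 := h.sum i hi
    have h3 := h.c_nonneg hi
    have h4 := h.b_nonneg hi
    rw [h1]
    split_ifs <;> linarith
  refine ⟨A.charpoly, A.charpoly_monic, by rw [Matrix.charpoly_natDegree_eq_dim]; simp, ?_, ?_⟩
  · intro z hz
    rw [mem_roots ((A.charpoly_monic.map _).ne_zero), ← Matrix.charpoly_map] at hz
    have hev : Module.End.HasEigenvalue (Matrix.toLin' (A.map (Int.castRingHom ℂ))) z := by
      rw [Module.End.hasEigenvalue_iff_isRoot_charpoly, Matrix.charpoly_toLin']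
      exact hz
    -- Gershgorin: the entries are nonnegative, so centre plus radius of each disc is a row sum of
    -- absolute values, at most `κ`.
    obtain ⟨k, hk⟩ := eigenvalue_mem_ball hev
    rw [Metric.mem_closedBall, dist_eq_norm] at hk
    have hnorm : ∀ j, ‖A.map (Int.castRingHom ℂ) k j‖ = triMatrix n c a b k j := by
      intro j
      have h1 : ((A k j : ℤ) : ℝ) = triMatrix n c a b k j := by rw [← hAr]; rfl
      rw [Matrix.map_apply, eq_intCast, Complex.norm_intCast, h1, abs_of_nonneg (hentry k j)]
    have h2 : ‖z‖ ≤ ‖A.map (Int.castRingHom ℂ) k k‖ + ‖z - A.map (Int.castRingHom ℂ) k k‖ := by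
      have := norm_add_le (A.map (Int.castRingHom ℂ) k k) (z - A.map (Int.castRingHom ℂ) k k)
      rwa [add_sub_cancel] at this
    have h3 := Finset.add_sum_erase Finset.univ
      (fun j => ‖A.map (Int.castRingHom ℂ) k j‖) (Finset.mem_univ k)
    have h4 : ∑ j, ‖A.map (Int.castRingHom ℂ) k j‖ ≤ κ := by
      simp only [hnorm]; exact hrow k
    linarith
  · intro θ hθ
    rw [Module.End.hasEigenvalue_iff_isRoot_charpoly, Matrix.charpoly_toLin', ← hAr,
      Matrix.charpoly_map, IsRoot, eval_map] at hθ
    exact hθ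

/-- The terms being distinct, at most one block other than the first carries the tail triple, and it
lies beyond the head, so `tail` counts all its places. Together with (iii) this bounds the remaining
blocks from below. -/
theorem diam_le_head_add_tail {κ lam g : ℕ} {G : Fin (g + 1) → ℕ × ℕ × ℕ}
    (hG : IsGraphicalSequence κ lam G) {ell : Fin (g + 1) → ℕ}
    (hlast : ell (Fin.last g) = 1) :
    diam ell ≤ head ell + tail κ lam G ell +
      ∑ i with i ≠ 0 ∧ G i ≠ (κ - lam - 1, lam, 1), ell i := by
  classical
  have htail : ∀ i, i ≠ 0 → G i = (κ - lam - 1, lam, 1) → ell i ≤ tail κ lam G ell := by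
    intro i hi hGi
    have hil : i ≠ Fin.last g := by
      rintro rfl
      have := hG.beta_last
      rw [hGi] at this
      exact absurd this (by norm_num)
    have h1 := start_add_le ell (Fin.pos_of_ne_zero hi)
    have h2 := start_add_le_diam ell hil
    rw [start_zero] at h1
    have hsub : Finset.Ico (start ell i) (start ell i + ell i) ⊆
        (Finset.Ioc (head ell) (diam ell)).filter
          fun i => tdSeq G ell i = (κ - lam - 1, lam, 1) := by
      intro m hm
      rw [Finset.mem_Ico] at hm
      rw [Finset.mem_filter, Finset.mem_Ioc, tdSeq_of_mem G ell hm.1 hm.2, head]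
      exact ⟨by omega, hGi⟩
    have := Finset.card_le_card hsub
    rwa [Nat.card_Ico, Nat.add_sub_cancel_left] at this
  have hsum : ∑ i with ¬ (i ≠ 0 ∧ G i ≠ (κ - lam - 1, lam, 1)), ell i ≤
      head ell + tail κ lam G ell := by
    have hset : (Finset.univ.filter fun i : Fin (g + 1) =>
        ¬ (i ≠ 0 ∧ G i ≠ (κ - lam - 1, lam, 1))) =
        insert 0 (Finset.univ.filter fun i => i ≠ 0 ∧ G i = (κ - lam - 1, lam, 1)) := by
      ext i
      simp only [Finset.mem_filter, Finset.mem_univ, true_and, Finset.mem_insert]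
      tauto
    rw [hset, Finset.sum_insert (by simp)]
    refine Nat.add_le_add le_rfl ?_
    by_cases hex : ∃ i, i ≠ 0 ∧ G i = (κ - lam - 1, lam, 1)
    · obtain ⟨i, hi0, hi⟩ := hex
      have : (Finset.univ.filter fun i => i ≠ 0 ∧ G i = (κ - lam - 1, lam, 1)) = {i} := by
        ext j
        simp only [Finset.mem_filter, Finset.mem_univ, true_and, Finset.mem_singleton]
        constructor
        · rintro ⟨_, hj⟩; exact hG.distinct (hj.trans hi.symm)
        · rintro rfl; exact ⟨hi0, hi⟩
      rw [this, Finset.sum_singleton]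
      exact htail i hi0 hi
    · rw [Finset.sum_eq_zero]
      · exact Nat.zero_le _
      · intro i hi
        exact absurd ⟨i, (Finset.mem_filter.1 hi).2⟩ hex
  rw [diam_eq_sum ell hlast,
    ← Finset.sum_filter_add_sum_filter_not _ (fun i => i ≠ 0 ∧ G i ≠ (κ - lam - 1, lam, 1))]
  omega

/-! ### Gaps `√β - √γ`, bad places and the oscillation interval -/

/-- The difference `√β - √γ` of a term. -/
noncomputable def rootGap (d : ℕ × ℕ × ℕ) : ℝ := √(d.2.2 : ℝ) - √(d.1 : ℝ)

/-- The difference of the roots of two numbers in `[1, q]` attains its extremes only at the two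
opposite corners; for triples these are the head and the tail. -/
theorem abs_sqrt_sub_sqrt_lt {x y q : ℕ} (hx : 1 ≤ x) (hy : 1 ≤ y) (hxq : x ≤ q) (hyq : y ≤ q)
    (h1 : ¬ (x = 1 ∧ y = q)) (h2 : ¬ (y = 1 ∧ x = q)) :
    |√(y : ℝ) - √(x : ℝ)| < √(q : ℝ) - 1 := by
  have key : ∀ {x y : ℕ}, 1 ≤ x → y ≤ q → ¬ (x = 1 ∧ y = q) →
      √(y : ℝ) - √(x : ℝ) < √(q : ℝ) - 1 := by
    intro x y hx hyq h1
    rcases hx.lt_or_eq with h | h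
    · have e1 : √((1 : ℕ) : ℝ) < √(x : ℝ) :=
        Real.sqrt_lt_sqrt (by positivity) (by exact_mod_cast h)
      have e2 : √(y : ℝ) ≤ √(q : ℝ) := Real.sqrt_le_sqrt (by exact_mod_cast hyq)
      rw [Nat.cast_one, Real.sqrt_one] at e1
      linarith
    · have hlt : y < q := lt_of_le_of_ne hyq fun h' => h1 ⟨h.symm, h'⟩
      have e2 : √(y : ℝ) < √(q : ℝ) :=
        Real.sqrt_lt_sqrt (by positivity) (by exact_mod_cast hlt)
      rw [← h, Nat.cast_one, Real.sqrt_one]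
      linarith
  rw [abs_lt]
  have k1 := key hx hyq h1
  have k2 := key hy hxq h2
  constructor <;> linarith

/-- Among the terms of a graphical sequence only those of the head and of the tail have the largest
value of `|√β - √γ|`. -/
theorem IsGraphicalSequence.abs_rootGap_lt {κ lam g : ℕ} {G : Fin (g + 1) → ℕ × ℕ × ℕ}
    (hG : IsGraphicalSequence κ lam G) (hlam : lam + 2 ≤ κ) {i : Fin (g + 1)} (hi0 : i ≠ 0)
    (hil : i ≠ Fin.last g) (hit : G i ≠ (κ - lam - 1, lam, 1)) :
    |rootGap (G i)| < rootGap (G 0) := by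
  obtain ⟨h1, h2, h3, h4, h5⟩ := hG.mem_V i (Fin.val_lt_last hil)
  have h0 : rootGap (G 0) = √((κ - lam - 1 : ℕ) : ℝ) - 1 := by
    rw [hG.first, rootGap]; simp
  rw [h0, rootGap]
  -- The bounds `γ, β ≤ κ - λ - 1` are the two inequalities for `α` in the definition of `V`.
  refine abs_sqrt_sub_sqrt_lt h2 h1 (by omega) (by omega) ?_ ?_
  · rintro ⟨e1, e2⟩
    refine hi0 (hG.distinct ?_)
    rw [hG.first]
    exact Prod.ext e1 (Prod.ext (by simp only; omega) e2)
  · rintro ⟨e1, e2⟩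
    exact hit (Prod.ext e2 (Prod.ext (by simp only; omega) e1))

/-- The number of places of the middle region that are not inside a block with index in `Gd`. -/
theorem exists_bad {κ g : ℕ} (G : Fin (g + 1) → ℕ × ℕ × ℕ) (ell : Fin (g + 1) → ℕ)
    (hlast : ell (Fin.last g) = 1) (T : ℝ) (Gd Z : Finset (Fin (g + 1)))
    (hZ : ∀ i, |rootGap (G i)| < T → i ∉ Gd → i ∈ Z) :
    ∃ bad : Finset ℕ, bad.card ≤ ∑ i ∈ Z, ell i + 2 * (g + 1) ∧
      ∀ j, j + 2 ≤ diam ell →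
        |√(bSeq κ G ell (j + 1)) - √(cSeq G ell (j + 1))| < T → j ∉ bad →
        1 ≤ j ∧ ∃ i ∈ Gd, tdSeq G ell j = G i ∧ tdSeq G ell (j + 1) = G i ∧
          tdSeq G ell (j + 2) = G i := by
  classical
  -- The bad centres of the recurrence: all places of the blocks in `Z` and the two ends of every
  -- block. Away from `S` the places `j`, `j + 1`, `j + 2` lie in one block. As place `1` begins a
  -- block, `j = 0` with its special entries is excluded too.
  set S : Finset ℕ := (Z.biUnion fun i => Finset.Ico (start ell i) (start ell i + ell i)) ∪
    (Finset.univ.image (start ell) ∪ Finset.univ.image fun i => start ell i + ell i - 1) with hS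
  have hScard : S.card ≤ ∑ i ∈ Z, ell i + 2 * (g + 1) := by
    refine (Finset.card_union_le _ _).trans (Nat.add_le_add ?_ ?_)
    · refine Finset.card_biUnion_le.trans (Finset.sum_le_sum fun i _ => ?_)
      rw [Nat.card_Ico, Nat.add_sub_cancel_left]
    · refine (Finset.card_union_le _ _).trans ?_
      have h1 := Finset.card_image_le (s := Finset.univ) (f := start ell)
      have h2 := Finset.card_image_le (s := Finset.univ) (f := fun i => start ell i + ell i - 1)
      rw [Finset.card_univ, Fintype.card_fin] at h1 h2
      omega
  refine ⟨S.image fun m => m - 1, Finset.card_image_le.trans hScard, ?_⟩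
  intro j hj hmid hbad
  have hjS : j + 1 ∉ S := fun h => hbad (Finset.mem_image.2 ⟨j + 1, h, by omega⟩)
  obtain ⟨i, _, hi1, hi2⟩ := exists_block ell (Fin.last g) (m := j + 1) (by omega)
    (by rw [hlast]; unfold diam at hj; omega)
  have htd := tdSeq_of_mem G ell hi1 hi2
  have hgap : |rootGap (G i)| < T := by
    rw [rootGap, ← htd]
    simpa [bSeq, cSeq] using hmid
  simp only [hS, Finset.mem_union, Finset.mem_biUnion, Finset.mem_image, Finset.mem_Ico,
    Finset.mem_univ, true_and, not_or, not_exists, not_and] at hjS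
  obtain ⟨s1, s2, s3⟩ := hjS
  have hiGd : i ∈ Gd := by
    by_contra hcon
    exact s1 i (hZ i hgap hcon) hi1 hi2
  have t2 := s2 i
  have t3 := s3 i
  have hst : 1 ≤ start ell i := by unfold start; omega
  exact ⟨by omega, i, hiGd, tdSeq_of_mem G ell (by omega) (by omega), htd,
    tdSeq_of_mem G ell (by omega) (by omega)⟩

open Filter Topology in
/-- An interval of values `θ` in which every block of positive weight is either oscillating or
growing, the head is growing, and some block of positive weight is oscillating. -/
theorem IsGraphicalSequence.exists_interval {κ lam g : ℕ} {G : Fin (g + 1) → ℕ × ℕ × ℕ}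
    (hG : IsGraphicalSequence κ lam G) (hlam : lam + 2 ≤ κ) {x : Fin (g + 1) → ℝ} (hx0 : 0 < x 0)
    (hxlast : x (Fin.last g) = 0)
    (hex : ∃ i, i ≠ 0 ∧ G i ≠ (κ - lam - 1, lam, 1) ∧ 0 < x i) :
    ∃ T T' δ : ℝ, 0 < T' ∧ T' < T ∧ T < rootGap (G 0) ∧ T ^ 2 ≤ κ ∧ 0 < δ ∧ δ ≤ 1 ∧
      (∃ i, 0 < x i ∧ |rootGap (G i)| < T) ∧
      ∀ i, 0 < x i → |rootGap (G i)| < T → i ≠ Fin.last g ∧ ∀ θ : ℝ, T' ^ 2 ≤ κ - θ →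
        κ - θ ≤ T ^ 2 →
        |θ - (G i).2.1| ≤ (1 - δ) * (2 * (√((G i).2.2 : ℝ) * √((G i).1 : ℝ))) := by
  classical
  obtain ⟨i1, hi10, hi1t, hxi1⟩ := hex
  set I := Finset.univ.filter fun i => 0 < x i with hI
  have hmemI : ∀ i, i ∈ I ↔ 0 < x i := fun i => by simp [hI]
  have hnl : ∀ i ∈ I, i ≠ Fin.last g := by
    rintro i hi rfl
    rw [hmemI, hxlast] at hi
    exact lt_irrefl _ hi
  -- Only blocks of positive weight compete for the smallest gap `μ`. A number `T` just above `μ`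
  -- then separates the blocks attaining `μ` from all others of positive weight; the given block
  -- `i1` ensures that `μ` is below the gap of the head.
  obtain ⟨i0, hi0, hmin⟩ := Finset.exists_min_image I (fun i => |rootGap (G i)|)
    ⟨0, (hmemI 0).2 hx0⟩
  set μ := |rootGap (G i0)| with hμ
  have hμ0 : 0 ≤ μ := abs_nonneg _
  have hμhead : μ < rootGap (G 0) :=
    (hmin i1 ((hmemI i1).2 hxi1)).trans_lt
      (hG.abs_rootGap_lt hlam hi10 (hnl i1 ((hmemI i1).2 hxi1)) hi1t)
  have hroots : ∀ i ∈ I, 0 < √((G i).2.2 : ℝ) ∧ 0 < √((G i).1 : ℝ) := by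
    intro i hi
    have h1 := hG.one_le_beta (hnl i hi)
    have h2 := hG.one_le_gamma i
    exact ⟨Real.sqrt_pos.2 (by exact_mod_cast h1), Real.sqrt_pos.2 (by exact_mod_cast h2)⟩
  have hsum : ∀ i ∈ I, μ < √((G i).2.2 : ℝ) + √((G i).1 : ℝ) := by
    intro i hi
    obtain ⟨h1, h2⟩ := hroots i hi
    refine (hmin i hi).trans_lt ?_
    rw [rootGap, abs_lt]
    constructor <;> linarith
  have hev : ∀ᶠ T in 𝓝[>] μ, T < rootGap (G 0) ∧ ∀ i ∈ I,
      T < √((G i).2.2 : ℝ) + √((G i).1 : ℝ) ∧ (μ < |rootGap (G i)| → T < |rootGap (G i)|) := by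
    have hlt : ∀ s, μ < s → ∀ᶠ T in 𝓝[>] μ, T < s := fun s hs => by
      filter_upwards [Ioo_mem_nhdsGT hs] with T hT using hT.2
    refine (hlt _ hμhead).and ((eventually_all_finset I).2 fun i hi => (hlt _ (hsum i hi)).and ?_)
    by_cases h : μ < |rootGap (G i)|
    · filter_upwards [hlt _ h] with T hT _ using hT
    · exact Eventually.of_forall fun T h' => absurd h' h
  obtain ⟨T, ⟨hThead, hTI⟩, hμT⟩ := (hev.and self_mem_nhdsWithin).exists
  set T' := (μ + T) / 2 with hT'
  have hμT' : μ < T' := by rw [hT']; linarith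
  have hT'T : T' < T := by rw [hT']; linarith
  have hT0 : 0 < T := hμ0.trans_lt hμT
  -- As `θ - α = β + γ - (κ - θ)`, this bounds `|θ - α|` when `κ - θ` lies in `[T' ^ 2, T ^ 2]`. It
  -- is below `2 √β √γ` because `|√β - √γ| = μ < T'` and `T < √β + √γ`.
  set ub : Fin (g + 1) → ℝ := fun i =>
    max ((G i).2.2 + (G i).1 - T' ^ 2) (T ^ 2 - ((G i).2.2 + (G i).1)) with hub
  set p : Fin (g + 1) → ℝ := fun i => 2 * (√((G i).2.2 : ℝ) * √((G i).1 : ℝ)) with hp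
  have hp0 : ∀ i ∈ I, 0 < p i := fun i hi => by
    obtain ⟨h1, h2⟩ := hroots i hi
    simp only [hp]; positivity
  have hub_lt : ∀ i ∈ I, |rootGap (G i)| < T → ub i < p i := by
    intro i hi hiT
    have hgap : |rootGap (G i)| = μ := by
      refine le_antisymm (not_lt.1 fun h => ?_) (hmin i hi)
      exact lt_irrefl _ (hiT.trans ((hTI i hi).2 h))
    have e1 : √((G i).2.2 : ℝ) ^ 2 = (G i).2.2 := Real.sq_sqrt (Nat.cast_nonneg _)
    have e2 : √((G i).1 : ℝ) ^ 2 = (G i).1 := Real.sq_sqrt (Nat.cast_nonneg _)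
    have e3 : (√((G i).2.2 : ℝ) - √((G i).1 : ℝ)) ^ 2 = μ ^ 2 := by
      rw [← hgap, sq_abs, rootGap]
    have e4 := (hTI i hi).1
    simp only [hub, hp]
    refine max_lt ?_ ?_
    · nlinarith
    · nlinarith
  have hevδ : ∀ᶠ δ in 𝓝[>] (0 : ℝ), δ < 1 ∧
      ∀ i ∈ I, |rootGap (G i)| < T → δ < 1 - ub i / p i := by
    have hlt : ∀ s : ℝ, 0 < s → ∀ᶠ δ in 𝓝[>] (0 : ℝ), δ < s := fun s hs => by
      filter_upwards [Ioo_mem_nhdsGT hs] with T hT using hT.2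
    refine (hlt 1 one_pos).and ((eventually_all_finset I).2 fun i hi => ?_)
    by_cases h : |rootGap (G i)| < T
    · have h1 : 0 < 1 - ub i / p i := by
        rw [sub_pos, div_lt_one (hp0 i hi)]; exact hub_lt i hi h
      filter_upwards [hlt _ h1] with δ hδ _ using hδ
    · exact Eventually.of_forall fun _ h' => absurd h' h
  obtain ⟨δ, ⟨hδ1, hδI⟩, hδ0⟩ := (hevδ.and self_mem_nhdsWithin).exists
  refine ⟨T, T', δ, hμ0.trans_lt hμT', hT'T, hThead, ?_, hδ0, hδ1.le,
    ⟨i0, (hmemI i0).1 hi0, hμT⟩, ?_⟩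
  · have h1 : T ≤ √(κ : ℝ) := by
      refine hThead.le.trans ?_
      rw [rootGap]
      have h2 : √((G 0).2.2 : ℝ) ≤ √(κ : ℝ) :=
        Real.sqrt_le_sqrt (by exact_mod_cast (by have := hG.sum_eq 0; omega))
      linarith [Real.sqrt_nonneg ((G 0).1 : ℝ)]
    calc T ^ 2 ≤ √(κ : ℝ) ^ 2 := by gcongr
      _ = (κ : ℝ) := Real.sq_sqrt (Nat.cast_nonneg _)
  · intro i hxi hiT
    have hi := (hmemI i).2 hxi
    refine ⟨hnl i hi, fun θ h1 h2 => ?_⟩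
    have h3 := hδI i hi hiT
    have h4 : ub i ≤ (1 - δ) * p i := by
      rw [← div_le_iff₀ (hp0 i hi)]; linarith
    have h5 : ((G i).1 : ℝ) + (G i).2.1 + (G i).2.2 = κ := by exact_mod_cast hG.sum_eq i
    refine le_trans ?_ h4
    rw [abs_le]
    constructor
    · have := le_max_right ((G i).2.2 + (G i).1 - T' ^ 2) (T ^ 2 - ((G i).2.2 + (G i).1) : ℝ)
      simp only [hub]; linarith
    · have := le_max_left ((G i).2.2 + (G i).1 - T' ^ 2) (T ^ 2 - ((G i).2.2 + (G i).1) : ℝ)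
      simp only [hub]; linarith

/-! ### The contradiction along sequences with growing heads -/

-- One factor `ρ ^ h` absorbs `K ^ B`, since `B = o(h)`; the other absorbs the linear factor `D +
-- 1`.
open Filter Topology in
theorem eventually_mul_pow_lt_pow {h B D : ℕ → ℕ} {A C K ρ : ℝ} (hh : Tendsto h atTop atTop)
    (hB : Tendsto (fun n => (B n : ℝ) / h n) atTop (𝓝 0)) (hD : ∀ n, (D n : ℝ) ≤ C * h n)
    (hA : 0 ≤ A) (hK : 1 ≤ K) (hρ : 1 < ρ) :
    ∀ᶠ n in atTop, (D n + 1) * (A * K ^ B n) < ρ ^ (2 * h n) := by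
  have h1 : ∀ᶠ n in atTop, K ^ B n ≤ ρ ^ h n := by
    have hlim : Tendsto (fun n => (B n : ℝ) / h n * Real.log K) atTop (𝓝 0) := by
      simpa using hB.mul_const (Real.log K)
    filter_upwards [hlim.eventually_lt_const (Real.log_pos hρ),
      hh.eventually_gt_atTop 0] with n hn hpos
    have hpos' : (0 : ℝ) < h n := by exact_mod_cast hpos
    rw [div_mul_eq_mul_div, div_lt_iff₀ hpos'] at hn
    rw [← Real.log_le_log_iff (by positivity) (by positivity), Real.log_pow, Real.log_pow]
    linarith
  have h2 : ∀ᶠ n in atTop, (C * h n + 1) * A < ρ ^ h n := by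
    have l1 := (tendsto_pow_const_div_const_pow_of_one_lt 1 hρ).comp hh
    have l0 := (tendsto_pow_const_div_const_pow_of_one_lt 0 hρ).comp hh
    have hlim := (l1.const_mul (C * A)).add (l0.const_mul A)
    simp only [mul_zero, add_zero] at hlim
    filter_upwards [hlim.eventually_lt_const one_pos] with n hn
    simp only [Function.comp_apply, pow_one, pow_zero] at hn
    have hpos : 0 < ρ ^ h n := by positivity
    rw [mul_div_assoc', mul_div_assoc', ← add_div, div_lt_one hpos] at hn
    linarith
  filter_upwards [h1, h2] with n hn1 hn2
  have hpos : 0 < ρ ^ h n := by positivity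
  calc (D n + 1) * (A * K ^ B n) = ((D n + 1) * A) * K ^ B n := by ring
    _ ≤ ((C * h n + 1) * A) * ρ ^ h n := by
        have := hD n
        gcongr
        nlinarith [(Nat.cast_nonneg (D n) : (0 : ℝ) ≤ D n)]
    _ < ρ ^ h n * ρ ^ h n := mul_lt_mul_of_pos_right hn2 hpos
    _ = ρ ^ (2 * h n) := by rw [two_mul, pow_add]

/-- Two eigenvalues in the good interval with the same Christoffel number are close. -/
theorem IsGraphicalSequence.abs_sub_le_of_christoffelNumber_eq {κ lam g : ℕ}
    {G : Fin (g + 1) → ℕ × ℕ × ℕ} (hG : IsGraphicalSequence κ lam G) (hκ : 1 ≤ κ)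
    {ell : Fin (g + 1) → ℕ} (hpos : ∀ i, 1 ≤ ell i) (hlast : ell (Fin.last g) = 1)
    {x : Fin (g + 1) → ℝ} (hx : ∀ i, 0 ≤ x i) {T T' δ r : ℝ}
    (hT0 : 0 < T) (hThead : T < rootGap (G 0)) (hTκ : T ^ 2 ≤ κ) (hδ : 0 < δ) (hδ1 : δ ≤ 1)
    (hr : 0 < r)
    (hosc : ∀ i, 0 < x i → |rootGap (G i)| < T → i ≠ Fin.last g ∧ ∀ θ : ℝ, T' ^ 2 ≤ κ - θ →
        κ - θ ≤ T ^ 2 →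
        |θ - (G i).2.1| ≤ (1 - δ) * (2 * (√((G i).2.2 : ℝ) * √((G i).1 : ℝ))))
    (hlarge : ((diam ell : ℝ) + 1) * (κ ^ 2 * (2 / δ) * ((1 + 2 * κ ^ 2) * (κ ^ 2 + 1)) *
      (2 * (1 + 2 * (κ : ℝ) ^ 2) / δ) ^ (∑ i with x i = 0, ell i + 2 * (g + 1))) <
        (1 + r / κ) ^ (2 * head ell))
    {θ η : ℝ} (hθ : T' ^ 2 ≤ κ - θ) (hθ' : κ - θ ≤ T ^ 2) (hη : T' ^ 2 ≤ κ - η)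
    (hη' : κ - η ≤ T ^ 2)
    (heθ : bSeq κ G ell (diam ell - 1) *
        (vPoly (cSeq G ell) (aSeq G ell) (bSeq κ G ell) (diam ell - 1)).eval θ =
      (θ - aSeq G ell (diam ell)) *
        (vPoly (cSeq G ell) (aSeq G ell) (bSeq κ G ell) (diam ell)).eval θ)
    (heη : bSeq κ G ell (diam ell - 1) *
        (vPoly (cSeq G ell) (aSeq G ell) (bSeq κ G ell) (diam ell - 1)).eval η =
      (η - aSeq G ell (diam ell)) *
        (vPoly (cSeq G ell) (aSeq G ell) (bSeq κ G ell) (diam ell)).eval η)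
    (hchr : christoffelNumber κ G ell θ = christoffelNumber κ G ell η) : |θ - η| ≤ r := by
  classical
  have hJ := hG.jacobiData hκ hpos hlast
  have hsum := hJ.sum_wSeq_eq_of_christoffel_eq hchr
  have hκ1 : (1 : ℝ) ≤ κ := hJ.one_le
  have hgn : (0 : Fin (g + 1)) ≠ Fin.last g := by
    intro h0
    have h1 := hG.beta_last
    rw [← h0] at h1
    have h2 : rootGap (G 0) ≤ 0 := by
      rw [rootGap, h1]
      simp
    linarith
  have hhead : head ell ≤ diam ell := by
    have := start_add_le_diam ell hgn
    rw [start_zero] at this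
    unfold head
    omega
  have hhead1 : 1 ≤ head ell := hpos 0
  have htdhead : tdSeq G ell (head ell) = G 0 :=
    tdSeq_of_mem G ell (by rw [start_zero]; exact hhead1) (by rw [start_zero, head]; omega)
  obtain ⟨bad, hbadcard, hbad⟩ := exists_bad (κ := κ) G ell hlast T
    (Finset.univ.filter fun i => 0 < x i ∧ |rootGap (G i)| < T)
    (Finset.univ.filter fun i => x i = 0) (by
      intro i hi hiG
      simp only [Finset.mem_filter, Finset.mem_univ, true_and, not_and] at hiG ⊢
      refine le_antisymm (not_lt.1 fun h => hiG h hi) (hx i))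
  have hK1 : 1 ≤ 2 * (1 + 2 * (κ : ℝ) ^ 2) / δ := by
    rw [le_div_iff₀ hδ]; nlinarith
  have key : ∀ θ η : ℝ, T' ^ 2 ≤ κ - θ → κ - θ ≤ T ^ 2 → T' ^ 2 ≤ κ - η →
      bSeq κ G ell (diam ell - 1) *
        (vPoly (cSeq G ell) (aSeq G ell) (bSeq κ G ell) (diam ell - 1)).eval θ =
      (θ - aSeq G ell (diam ell)) *
        (vPoly (cSeq G ell) (aSeq G ell) (bSeq κ G ell) (diam ell)).eval θ →
      θ + r ≤ η →
      ∑ j ∈ Finset.range (diam ell + 1), wSeq (cSeq G ell) (aSeq G ell) (bSeq κ G ell) θ j ^ 2 <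
      ∑ j ∈ Finset.range (diam ell + 1), wSeq (cSeq G ell) (aSeq G ell) (bSeq κ G ell) η j ^ 2 := by
    intro θ η h1 h2 h3 heig hθη
    set P : ℕ → Prop := fun j => 1 ≤ j ∧ ∃ i, (0 < x i ∧ |rootGap (G i)| < T) ∧ tdSeq G ell j = G i
      with hP
    have hroot : ∀ i, i ≠ Fin.last g → 0 < √((G i).2.2 : ℝ) * √((G i).1 : ℝ) := by
      intro i hi
      have h1 := hG.one_le_beta hi
      have h2 := hG.one_le_gamma i
      have p1 : 0 < √((G i).2.2 : ℝ) := Real.sqrt_pos.2 (by exact_mod_cast h1)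
      have p2 : 0 < √((G i).1 : ℝ) := Real.sqrt_pos.2 (by exact_mod_cast h2)
      positivity
    refine hJ.sum_wSeq_lt (T := T) (r := r) (δ := δ) (hd := head ell) bad
      -- The cosine of the rotation angle in the block containing `j`. The value `0` elsewhere
      -- satisfies the bound `1 - δ` and enters no condition at the good places.
      (fun j => if P j then
        (θ - (tdSeq G ell j).2.1) / (2 * (√((tdSeq G ell j).2.2 : ℝ) * √((tdSeq G ell j).1 : ℝ)))
        else 0) (by linarith) h2 hT0 hr hθη (by nlinarith [sq_nonneg T']) heig hhead1 hhead ?_ hδ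
      hδ1 ?_ ?_ ?_
    · simp only [bSeq, cSeq, if_neg (by omega : ¬ head ell = 0), htdhead]
      exact hThead.le
    · intro j
      split_ifs with hj
      · obtain ⟨_, i, ⟨hi1, hi2⟩, hi3⟩ := hj
        obtain ⟨hil, hi⟩ := hosc i hi1 hi2
        have hp := hroot i hil
        rw [hi3, abs_div, abs_of_pos (by linarith : 0 < 2 * (√((G i).2.2 : ℝ) * √((G i).1 : ℝ))),
          div_le_iff₀ (by linarith)]
        exact hi θ h1 h2
      · simp only [abs_zero]; linarith
    · intro j hj hmid hjb
      obtain ⟨hj1, i, hi, e0, e1, e2⟩ := hbad j hj hmid hjb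
      have hi' := (Finset.mem_filter.1 hi).2
      have P0 : P j := ⟨hj1, i, hi', e0⟩
      have P1 : P (j + 1) := ⟨by omega, i, hi', e1⟩
      have hp := hroot i (hosc i hi'.1 hi'.2).1
      simp only [if_pos P0, if_pos P1, bSeq, cSeq, aSeq, if_neg (by omega : ¬ j = 0),
        if_neg (by omega : ¬ j + 1 = 0), e0, e1, e2, true_and]
      generalize √((G i).2.2 : ℝ) * √((G i).1 : ℝ) = q at hp ⊢
      field_simp
    · refine lt_of_le_of_lt ?_ hlarge
      refine mul_le_mul_of_nonneg_left ?_ (by positivity)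
      have hpow := pow_le_pow_right₀ hK1 hbadcard
      calc _ = (κ : ℝ) ^ 2 * (2 / δ) * ((1 + 2 * κ ^ 2) * (κ ^ 2 + 1)) *
            (2 * (1 + 2 * (κ : ℝ) ^ 2) / δ) ^ bad.card := by ring
        _ ≤ _ := by gcongr
  by_contra hcon
  rw [not_le, lt_abs] at hcon
  rcases hcon with h | h
  · exact absurd hsum (key η θ hη hη' hθ heη (by linarith)).ne'
  · exact absurd hsum (key θ η hθ hθ' hη heθ (by linarith)).ne

open Filter Topology in
/-- Along a sequence of tridiagonal sequences whose blocks have limiting proportions relative to the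
head, property (AC) fails if a block that is neither head nor tail has positive weight. -/
theorem IsGraphicalSequence.not_forall_propertyAC {κ lam g : ℕ} {G : Fin (g + 1) → ℕ × ℕ × ℕ}
    (hG : IsGraphicalSequence κ lam G) (hκ : 1 ≤ κ) (hlam : lam + 2 ≤ κ)
    {ell : ℕ → Fin (g + 1) → ℕ} (hpos : ∀ n i, 1 ≤ ell n i)
    (hlast : ∀ n, ell n (Fin.last g) = 1) {C : ℝ} (hC : 0 < C)
    (hD : ∀ n, (diam (ell n) : ℝ) ≤ C * head (ell n))
    (hh : Tendsto (fun n => head (ell n)) atTop atTop) {x : Fin (g + 1) → ℝ}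
    (hx : ∀ i, Tendsto (fun n => (ell n i : ℝ) / head (ell n)) atTop (𝓝 (x i)))
    (hex : ∃ i, i ≠ 0 ∧ G i ≠ (κ - lam - 1, lam, 1) ∧ 0 < x i) :
    ¬ ∀ n, PropertyAC κ G (ell n) := by
  classical
  intro hAC
  have hhR : Tendsto (fun n => (head (ell n) : ℝ)) atTop atTop :=
    tendsto_natCast_atTop_atTop.comp hh
  have hx0 : x 0 = 1 := by
    refine tendsto_nhds_unique (hx 0) (tendsto_const_nhds.congr' ?_)
    filter_upwards [hh.eventually_gt_atTop 0] with n hn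
    have : (head (ell n) : ℝ) ≠ 0 := by positivity
    rw [head] at *
    rw [div_self this]
  have hxlast : x (Fin.last g) = 0 := by
    refine tendsto_nhds_unique (hx _) ?_
    simp only [hlast, Nat.cast_one]
    exact tendsto_const_nhds.div_atTop hhR
  have hxnn : ∀ i, 0 ≤ x i := fun i => ge_of_tendsto' (hx i) fun n => by positivity
  obtain ⟨T, T', δ, hT'0, hT'T, hThead, hTκ, hδ, hδ1, ⟨i0, hxi0, hi0T⟩, hosc⟩ :=
    hG.exists_interval hlam (by rw [hx0]; exact one_pos) hxlast hex
  have hT0 : 0 < T := hT'0.trans hT'T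
  obtain ⟨hi0l, hi0⟩ := hosc i0 hxi0 hi0T
  -- Midpoint `m` and half-length `w` of the interval of admissible `θ`.
  set m : ℝ := κ - (T ^ 2 + T' ^ 2) / 2 with hm
  set w : ℝ := (T ^ 2 - T' ^ 2) / 2 with hw
  have hw0 : 0 < w := by rw [hw]; nlinarith
  have hmem : ∀ θ : ℝ, |θ - m| ≤ w → T' ^ 2 ≤ κ - θ ∧ κ - θ ≤ T ^ 2 := by
    intro θ hθ
    rw [abs_le] at hθ
    rw [hm, hw] at hθ
    constructor <;> linarith [hθ.1, hθ.2]
  have hmi0 : |m - (G i0).2.1| < 2 * (√((G i0).2.2 : ℝ) * √((G i0).1 : ℝ)) := by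
    obtain ⟨h1, h2⟩ := hmem m (by simpa using hw0.le)
    refine (hi0 m h1 h2).trans_lt ?_
    have hp : 0 < √((G i0).2.2 : ℝ) * √((G i0).1 : ℝ) :=
      mul_pos (Real.sqrt_pos.2 (by exact_mod_cast hG.one_le_beta hi0l))
        (Real.sqrt_pos.2 (by exact_mod_cast hG.one_le_gamma i0))
    nlinarith
  obtain ⟨K, hK⟩ := exists_eigenvalues_of_block hmi0 hw0
  have hK2 : (0 : ℝ) < K + 2 := by positivity
  -- With `X = x i0 * h / (8 * (K + 2))`, the block `i0` yields more than `4 X - 1` eigenvalues,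
  -- while the arithmetic bound is at most `N + X + c`. The last condition in the choice of `n`
  -- below gives `N + 1 + c < X`, so the two are incompatible.
  set c : ℝ := x i0 / (8 * (C + 1) * (K + 2)) with hc
  have hc0 : 0 < c := by positivity
  obtain ⟨r, hr, N, hNT⟩ := card_le_of_isConjRoot_close (R := κ) (c := c)
    (by exact_mod_cast hκ) hc0
  -- The bad places are block ends and places of blocks of weight zero, so their number is `o(h)`.
  have hB : Tendsto (fun n => ((∑ i with x i = 0, ell n i + 2 * (g + 1) : ℕ) : ℝ) /
      head (ell n)) atTop (𝓝 0) := by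
    have h1 : Tendsto (fun n => ∑ i with x i = 0, (ell n i : ℝ) / head (ell n)) atTop
        (𝓝 (∑ i with x i = 0, x i)) := tendsto_finsetSum _ fun i _ => hx i
    have h2 : ∑ i with x i = 0, x i = 0 :=
      Finset.sum_eq_zero fun i hi => (Finset.mem_filter.1 hi).2
    have h3 : Tendsto (fun n => (2 * (g + 1) : ℝ) / head (ell n)) atTop (𝓝 0) :=
      tendsto_const_nhds.div_atTop hhR
    rw [h2] at h1
    have h4 := h1.add h3
    rw [add_zero] at h4
    refine h4.congr fun n => ?_
    rw [← Finset.sum_div, ← add_div]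
    push_cast
    rfl
  have hκ0 : (0 : ℝ) < κ := by exact_mod_cast hκ
  have hlarge := eventually_mul_pow_lt_pow hh hB hD
    (A := κ ^ 2 * (2 / δ) * ((1 + 2 * κ ^ 2) * (κ ^ 2 + 1))) (by positivity)
    (K := 2 * (1 + 2 * (κ : ℝ) ^ 2) / δ)
    (by rw [le_div_iff₀ hδ]; nlinarith) (ρ := 1 + r / κ)
    (by have : 0 < r / κ := by positivity
        linarith)
  have hlong : ∀ᶠ n in atTop, x i0 / 2 < (ell n i0 : ℝ) / head (ell n) :=
    (hx i0).eventually_const_lt (by linarith)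
  obtain ⟨n, hn1, hn2, hn3, hn4⟩ := (hlarge.and (hlong.and ((hhR.eventually_gt_atTop 0).and
    (hhR.eventually_gt_atTop ((N + 1 + c) * (8 * (K + 2)) / x i0))))).exists
  have hJ := hG.jacobiData hκ (hpos n) (hlast n)
  obtain ⟨E, hEcard, hE⟩ := hK _ _ _ _ _ hJ (start (ell n) i0) (ell n i0)
    (by unfold start; omega) (start_add_le_diam (ell n) hi0l) (by
      intro i h1 h2
      have h3 := tdSeq_of_mem G (ell n) h1 h2
      have h4 : ¬ i = 0 := by unfold start at h1; omega
      simp only [bSeq, cSeq, aSeq, if_neg h4, h3, and_self])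
  obtain ⟨P, hPm, hPdeg, hProots, hPeig⟩ := hJ.exists_int_polynomial
    (fun i => (tdSeq G (ell n) i).1) (fun i => if i = 0 then 0 else (tdSeq G (ell n) i).2.1)
    (fun i => if i = 0 then κ else (tdSeq G (ell n) i).2.2) (fun i => by simp [cSeq])
    (fun i => by rw [aSeq]; split_ifs <;> simp) (fun i => by rw [bSeq]; split_ifs <;> simp)
  have heig : ∀ θ ∈ E, θ ∈ eigenvalues κ G (ell n) := fun θ hθ =>
    hJ.hasEigenvalue_triMatrix (hE θ hθ).2
  have hcount := hNT P hPm hProots E (fun θ hθ => hPeig θ (heig θ hθ)) (by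
    intro θ hθ η hη hconj
    obtain ⟨h1, h2⟩ := hmem θ (hE θ hθ).1
    obtain ⟨h3, h4⟩ := hmem η (hE η hη).1
    exact hG.abs_sub_le_of_christoffelNumber_eq hκ (hpos n) (hlast n) hxnn hT0 hThead hTκ hδ hδ1 hr
      hosc hn1 h1 h2 h3 h4 (hE θ hθ).2 (hE η hη).2
      (hAC n θ (heig θ hθ) η (heig η hη) hconj))
  rw [hPdeg] at hcount
  push_cast at hcount
  have hfloor : (ell n i0 : ℝ) / (K + 2) < E.card + 1 := by
    rw [div_lt_iff₀ hK2]
    have h1 := Nat.lt_mul_div_succ (ell n i0) (by omega : 0 < K + 2)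
    have h2 : ell n i0 < (K + 2) * (E.card + 1) :=
      h1.trans_le (Nat.mul_le_mul_left _ (Nat.succ_le_succ hEcard))
    have h3 : (ell n i0 : ℝ) < (K + 2) * (E.card + 1) := by exact_mod_cast h2
    linarith
  rw [lt_div_iff₀ hn3] at hn2
  rw [div_lt_iff₀ hxi0] at hn4
  have hDn := hD n
  set h := (head (ell n) : ℝ)
  have h1 : x i0 / 2 * h / (K + 2) < E.card + 1 :=
    lt_of_le_of_lt (div_le_div_of_nonneg_right hn2.le hK2.le) hfloor
  have h2 : c * (diam (ell n) + 1) ≤ c * (C + 1) * h + c := by nlinarith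
  have h3 : c * (C + 1) * h = x i0 * h / (8 * (K + 2)) := by
    rw [hc]; field_simp
  have h4 : N + 1 + c < x i0 * h / (8 * (K + 2)) := by
    rw [lt_div_iff₀ (by positivity)]; linarith
  have h5 : x i0 / 2 * h / (K + 2) = 4 * (x i0 * h / (8 * (K + 2))) := by
    field_simp; ring
  have h6 : 0 < x i0 * h / (8 * (K + 2)) := by positivity
  linarith

end BI

open Filter Topology in
theorem theorem4p2 (κ lam : ℕ) (hκ : 3 ≤ κ) (hlam : lam + 2 ≤ κ) (g : ℕ)
    (G : Fin (g + 1) → ℕ × ℕ × ℕ) (hG : BI.IsGraphicalSequence κ lam G)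
    (Δ : Finset (Fin (g + 1))) (hfirst : 0 ∈ Δ) (hlast : Fin.last g ∉ Δ)
    (L : {i : Fin (g + 1) // i ∉ Δ} → ℕ) (hL : ∀ i, 1 ≤ L i) :
    ∃ F : ℝ, 0 < F ∧
      ∀ ε : ℝ, 0 < ε → ∀ C : ℝ, 0 < C →
        ∃ H : ℝ, 0 < H ∧
          ∀ ell : Fin (g + 1) → ℕ,
            BI.IsQuadruple κ lam G Δ L ell →
            BI.PropertyAC κ G ell →
            (BI.diam ell : ℝ) ≤ C * BI.head ell →
            ε * BI.head ell <
              (BI.diam ell : ℝ) - ((BI.head ell : ℝ) + BI.tail κ lam G ell) →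
            (∀ i ∈ Δ, F < (ell i : ℝ)) →
            (BI.head ell : ℝ) ≤ H := by
  classical
  refine ⟨1, one_pos, fun ε hε C hC => ?_⟩
  by_contra! hno
  -- The failure of `H = n + 1` for every `n` supplies a sequence of examples whose heads tend to
  -- infinity.
  choose ell hquad hAC hD hε' _ hbig using fun n : ℕ => hno (n + 1) (by positivity)
  have hle : ∀ n i, ell n i ≤ BI.diam (ell n) := fun n i => by
    rw [BI.diam_eq_sum _ (hquad n).ell_last]
    exact Finset.single_le_sum (fun _ _ => Nat.zero_le _) (Finset.mem_univ i)
  have hheadpos : ∀ n, (0 : ℝ) < BI.head (ell n) := fun n => by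
    have := (hquad n).ell_pos 0
    rw [BI.head]
    exact_mod_cast this
  have hmem : ∀ n, (fun i => (ell n i : ℝ) / BI.head (ell n)) ∈
      Set.Icc (fun _ : Fin (g + 1) => (0 : ℝ)) fun _ => C := by
    intro n
    refine ⟨fun i => by positivity, fun i => ?_⟩
    beta_reduce
    rw [div_le_iff₀ (hheadpos n)]
    exact le_trans (by exact_mod_cast hle n i) (hD n)
  obtain ⟨x, _, φ, hφ, hx⟩ := isCompact_Icc.tendsto_subseq hmem
  rw [tendsto_pi_nhds] at hx
  have hh : Tendsto (fun n => BI.head (ell n)) atTop atTop := by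
    refine tendsto_atTop_mono (fun n => ?_) tendsto_id
    have h1 : ((n + 1 : ℕ) : ℝ) < BI.head (ell n) := by push_cast; exact hbig n
    have h2 : n + 1 < BI.head (ell n) := by exact_mod_cast h1
    simp only [id]
    omega
  refine hG.not_forall_propertyAC (by omega) hlam (ell := fun n => ell (φ n))
    (fun n => (hquad _).ell_pos) (fun n => (hquad _).ell_last) hC (fun n => hD _)
    (hh.comp hφ.tendsto_atTop) hx ?_ fun n => hAC _
  by_contra! hcon
  have hlim : Tendsto (fun n => ∑ i with i ≠ 0 ∧ G i ≠ (κ - lam - 1, lam, 1),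
      (ell (φ n) i : ℝ) / BI.head (ell (φ n))) atTop
      (𝓝 (∑ i with i ≠ 0 ∧ G i ≠ (κ - lam - 1, lam, 1), x i)) :=
    tendsto_finsetSum _ fun i _ => hx i
  have hle0 : ∑ i with i ≠ 0 ∧ G i ≠ (κ - lam - 1, lam, 1), x i ≤ 0 :=
    Finset.sum_nonpos fun i hi => hcon i (Finset.mem_filter.1 hi).2.1 (Finset.mem_filter.1 hi).2.2
  -- Condition (iii), divided by the head, passes to the limit and forces positive weight on a block
  -- that is neither head nor tail.
  have hge : ε ≤ ∑ i with i ≠ 0 ∧ G i ≠ (κ - lam - 1, lam, 1), x i := by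
    refine ge_of_tendsto' hlim fun n => ?_
    rw [← Finset.sum_div, le_div_iff₀ (hheadpos _)]
    have h1 := BI.diam_le_head_add_tail hG (hquad (φ n)).ell_last
    have h2 : (BI.diam (ell (φ n)) : ℝ) ≤ BI.head (ell (φ n)) + BI.tail κ lam G (ell (φ n)) +
        ∑ i with i ≠ 0 ∧ G i ≠ (κ - lam - 1, lam, 1), (ell (φ n) i : ℝ) := by
      exact_mod_cast h1
    linarith [hε' (φ n)]
  linarith
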